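/- **Setting.** Let $\mathbb F$ be a finite field with $q$ elements, $C$ a geometrically irreducible smooth projective curve over $\mathbb F$, $\infty$ a closed point of $C$, $A=H^0(C\setminus\{\infty\},\mathcal O_C)$ and $K=\operatorname{Frac}A$ the function field of $C$. Let $K_\infty$ be the completion of $K$ at $\infty$, $K_\infty^s$ a separable closure and $\mathbb C_\infty$ its completion, with their canonical absolute value $|\cdot|$. Tensor products without index are over $\mathbb F$. Let $\mathfrak j=\ker(A\otimes K\to K,\ a\otimes c\mapsto ac)$ and let $\tau$ be the map $a\otimes c\mapsto a\otimes c^q$. An $A$-motive over $K$ is a finite projective $A\otimes K$-module $M$ with an isomorphism $\tau_M:(\tau^*M)|_U\to M|_U$ over $U=\operatorname{Spec}(A\otimes K)\setminus V(\mathfrak j)$. For a field $L$ with $K_\infty\subseteq L\subseteq\mathbb C_\infty$ and $\rho\in|L^\times|$, $\rho\ge 1$, let $L\langle A\rangle_\rho$ be the completion of $A\otimes L$ for the norm $\|f\|_\rho=\inf\max_i|\ell_i|\rho^{\deg a_i}$, the infimum being over all representations $f=\sum_i a_i\otimes \ell_i$ with $a_i\neq 0$, where $\deg a=-[\kappa(\infty):\mathbb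 F]\,v_\infty(a)$. Put $L\langle A\rangle=L\langle A\rangle_1$, $\mathfrak X_\rho=\operatorname{Sp}L\langle A\rangle_\rho$, and let $\mathfrak X_L=\bigcup_\rho\mathfrak X_\rho$ be the rigid analytification of $\operatorname{Spec}(A\otimes L)$. The map $\tau$ extends continuously to all these rings. Let $J_m$ be the divisor $\mathfrak j+\tau\mathfrak j+\dots+\tau^m\mathfrak j$ on $\mathfrak X_L$, where $\tau^i\mathfrak j$ is the ideal generated by the image of $\mathfrak j$ under $\tau^i$, and let $\mathcal O_{\mathfrak X}(n\cdot J)=\operatorname{colim}_m\mathcal O_{\mathfrak X}(n\cdot J_m)$ be the sheaf of meromorphic functions with poles of order at most $n$ along $J=\mathfrak j+\tau\mathfrak j+\tau^2\mathfrak j+\cdots$. All $\tau^i\mathfrak j$ generate the unit ideal of $L\langle A\rangle$; hence $\mathcal O_{\mathfrak X}(n\cdot J)(\operatorname{Sp}L\langle A\rangle)=L\langle A\rangle$, and $f\mapsto\tau_M(\tau^*f)$ is defined on $M\otimes_{A\otimes K}L\langle A\rangle$ and on $M\otimes_{A\otimes K}\mathbb C_\infty\langle A\rangle$. For $f\in M\otimes_{A\otimes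 K}\mathcal O_{\mathfrak X}(n\cdot J)(\mathfrak X_L)$ the equation $\tau_M(\tau^*f)=f$ is understood among meromorphic functions with values in $M$. The exponent $\tau_M=1$ denotes the $A$-module of solutions of $\tau_M(\tau^* f)=f$. The Betti realization of $M$ is the $A$-module $$M_B=(M\otimes_{A\otimes K}\mathbb C_\infty\langle A\rangle)^{\tau_M=1},$$ and $M$ is called rigid analytically trivial if the multiplication map $M_B\otimes_A\mathbb C_\infty\langle A\rangle\to M\otimes_{A\otimes K}\mathbb C_\infty\langle A\rangle$ is bijective. **Theorem.** Let $(M,\tau_M)$ be a rigid analytically trivial $A$-motive over $K$, and let $L\subseteq K_\infty^s$ be a finite (separable) extension of $K_\infty$ such that $M_B$ is contained in $M\otimes_{A\otimes K}L\langle A\rangle$. Then the inclusion $L\langle A\rangle\subseteq\mathbb C_\infty\langle A\rangle$ induces an isomorphism of $A$-modules $(M\otimes_{A\otimes K}L\langle A\rangle)^{\tau_M=1}\cong M_B$, and for all sufficiently large integers $n$ the restriction map $\mathcal O_{\mathfrak X}(n\cdot J)(\mathfrak X_L)\to L\langle A\rangle$ induces an isomorphism of $A$-modules $$\bigl(M\otimes_{A\otimes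 K}\mathcal O_{\mathfrak X}(n\cdot J)(\mathfrak X_L)\bigr)^{\tau_M=1}\;\xrightarrow{\ \sim\ }\;(M\otimes_{A\otimes K}L\langle A\rangle)^{\tau_M=1}\cong M_B .$$ -/

import Mathlib

open scoped TensorProduct NNReal WithZero

set_option linter.unusedSectionVars false

noncomputable section

namespace AMotive

section Curve

variable (F K : Type*) [Field F] [Field K] [Algebra F K]

/-- `K` is the function field of a smooth projective geometrically irreducible curve over the
finite field `F`: it is finitely generated of transcendence degree one over `F`, and `F` is
algebraically closed in `K`. -/
structure IsCurveFunctionField : Prop where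
  fg : (⊤ : IntermediateField F K).FG
  trdeg_eq_one : Algebra.trdeg F K = 1
  mem_range_of_isAlgebraic : ∀ x : K, IsAlgebraic F x → x ∈ (algebraMap F K).range

/-- A place of `K / F`, i.e. a nontrivial valuation ring of `K` containing `F`. When `K` is the
function field of a smooth projective curve `C`, these are the local rings of the closed points
of `C`. -/
structure Place where
  ring : ValuationSubring K
  algebraMap_mem : ∀ c : F, algebraMap F K c ∈ ring
  ne_top : ring ≠ ⊤

end Curve

section Basic

variable {F K : Type*} [Field F] [Field K] [Algebra F K] (P : Place F K)

instance : Algebra F P.ring :=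
  ((algebraMap F K).codRestrict P.ring.toSubring P.algebraMap_mem).toAlgebra

/-- The ring `A = H⁰(C ∖ {∞}, 𝒪_C)` of functions which are regular away from the closed
point `∞`, written `P`. -/
def regularAway : Subalgebra F K where
  carrier := {f | ∀ Q : Place F K, Q ≠ P → f ∈ Q.ring}
  mul_mem' hf hg Q hQ := mul_mem (hf Q hQ) (hg Q hQ)
  add_mem' hf hg Q hQ := add_mem (hf Q hQ) (hg Q hQ)
  algebraMap_mem' c Q _ := Q.algebraMap_mem c

variable [IsDiscreteValuationRing P.ring]

/-- The normalized discrete valuation of `K` at `∞`, written multiplicatively. -/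
def val : Valuation K ℤᵐ⁰ := (IsDiscreteValuationRing.maximalIdeal P.ring).valuation K

/-- The degree `deg a = - [κ(∞) : F] · v_∞(a)` (with junk value `0` at `a = 0`). -/
def deg (a : K) : ℤ :=
  (Module.finrank F (IsLocalRing.ResidueField P.ring) : ℤ) * WithZero.log (val P a)

variable {P}

lemma val_le_one_iff {x : K} : val P x ≤ 1 ↔ x ∈ P.ring := by
  constructor
  · intro h
    obtain ⟨a, rfl⟩ := IsDiscreteValuationRing.exists_lift_of_le_one h
    exact a.2
  · intro h
    exact (IsDiscreteValuationRing.maximalIdeal P.ring).valuation_le_one (K := K) ⟨x, h⟩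

/-- A nonzero element of `A` does not vanish at `∞`. -/
lemma one_le_val [Fintype F] {a : K} (ha : a ∈ regularAway P) (h0 : a ≠ 0) : 1 ≤ val P a := by
  by_contra! hlt
  have hmem : ∀ V : ValuationSubring K, (∀ c : F, algebraMap F K c ∈ V) → a ∈ V := by
    intro V hV
    by_cases htop : V = ⊤
    · rw [htop]; trivial
    · by_cases hP : (⟨V, hV, htop⟩ : Place F K) = P
      · have := val_le_one_iff.1 hlt.le
        rw [← hP] at this
        exact this
      · exact ha _ hP
  have hint : a ∈ (integralClosure (Subring.closure (Set.range (algebraMap F K))) K).toSubring := by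
    rw [← iInf_valuationSubring_superset, Subring.mem_iInf]
    exact fun V ↦ hmem V.1 fun c ↦ V.2 ⟨c, rfl⟩
  have hcl : Subring.closure (Set.range (algebraMap F K)) = (algebraMap F K).range := by
    rw [← RingHom.coe_range, Subring.closure_eq]
  rw [hcl] at hint
  have halg : IsIntegral F a := by
    obtain ⟨p, hp, hpa⟩ := hint
    obtain ⟨p', hp', hdeg, hmon⟩ := Polynomial.lifts_and_degree_eq_and_monic
      (f := (algebraMap F K).rangeRestrict)
      ((Polynomial.lifts_iff_coeffs_subset_range p).2 (by
        rintro x -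
        exact (algebraMap F K).rangeRestrict_surjective x)) hp
    refine ⟨p', hmon, ?_⟩
    rw [← hp', Polynomial.eval₂_map] at hpa
    exact hpa
  have hfin : Finite (IntermediateField.adjoin F {a}) := by
    have := IntermediateField.adjoin.finiteDimensional halg
    exact Module.finite_of_finite F
  let b : (IntermediateField.adjoin F {a})ˣ :=
    Units.mk0 ⟨a, IntermediateField.mem_adjoin_simple_self F a⟩ (by
      intro h; exact h0 (congrArg Subtype.val h))
  obtain ⟨n, hn, hb⟩ := (isOfFinOrder_of_finite b).exists_pow_eq_one
  have han : a ^ n = 1 := by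
    have := congrArg (fun u : (IntermediateField.adjoin F {a})ˣ ↦ ((u : _) : K)) hb
    simpa [b] using this
  have : val P a ^ n = 1 := by rw [← map_pow, han, map_one]
  have h2 : val P a ^ n < 1 := pow_lt_one₀ zero_le hlt hn.ne'
  exact h2.ne this

lemma deg_nonneg [Fintype F] {a : K} (ha : a ∈ regularAway P) (h0 : a ≠ 0) : 0 ≤ deg P a := by
  refine mul_nonneg (by positivity) ?_
  rw [← WithZero.log_one, WithZero.log_le_log one_ne_zero ((Valuation.ne_zero_iff _).2 h0)]
  exact one_le_val ha h0

lemma deg_mul {a b : K} (ha : a ≠ 0) (hb : b ≠ 0) : deg P (a * b) = deg P a + deg P b := by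
  rw [deg, map_mul, WithZero.log_mul ((Valuation.ne_zero_iff _).2 ha)
    ((Valuation.ne_zero_iff _).2 hb), mul_add]; rfl

lemma deg_one : deg P (1 : K) = 0 := by simp [deg]

end Basic

section Fields

variable {F K : Type*} [Field F] [Fintype F] [Field K] [Algebra F K] (P : Place F K)
  [IsDiscreteValuationRing P.ring]

/-- The completion `K_∞` of `K` at `∞`. -/
def Kinf : Type _ := (IsDiscreteValuationRing.maximalIdeal P.ring).adicCompletion K

instance : Field (Kinf P) := inferInstanceAs
  (Field ((IsDiscreteValuationRing.maximalIdeal P.ring).adicCompletion K))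

instance : Valued (Kinf P) ℤᵐ⁰ := inferInstanceAs
  (Valued ((IsDiscreteValuationRing.maximalIdeal P.ring).adicCompletion K) ℤᵐ⁰)

instance : Algebra K (Kinf P) := inferInstanceAs
  (Algebra K ((IsDiscreteValuationRing.maximalIdeal P.ring).adicCompletion K))

instance : Algebra F (Kinf P) := ((algebraMap K (Kinf P)).comp (algebraMap F K)).toAlgebra

instance : IsScalarTower F K (Kinf P) := .of_algebraMap_eq fun _ ↦ rfl

lemma one_lt_card_nnreal : 1 < (Fintype.card F : ℝ≥0) := by
  exact_mod_cast Fintype.one_lt_card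

instance : (Valued.v : Valuation (Kinf P) ℤᵐ⁰).IsRankOneDiscrete := inferInstanceAs
  (Valued.v : Valuation ((IsDiscreteValuationRing.maximalIdeal P.ring).adicCompletion K)
    ℤᵐ⁰).IsRankOneDiscrete

/-- The canonical absolute value `|x| = q ^ (- v_∞(x))` of `K_∞`, where `q = #F`. -/
instance : (Valued.v : Valuation (Kinf P) ℤᵐ⁰).RankOne :=
  Valuation.IsRankOneDiscrete.rankOne _ (one_lt_card_nnreal (F := F))

instance : NontriviallyNormedField (Kinf P) := Valued.toNontriviallyNormedField (Kinf P) ℤᵐ⁰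

instance : IsUltrametricDist (Kinf P) :=
  inferInstanceAs (@IsUltrametricDist (Kinf P) (Valued.toNormedField (Kinf P) ℤᵐ⁰).toDist)

instance : CompleteSpace (Kinf P) := inferInstanceAs
  (CompleteSpace ((IsDiscreteValuationRing.maximalIdeal P.ring).adicCompletion K))

/-- The separable closure of `K_∞`, with the unique extension of the absolute value. -/
def Ksep : Type _ := SeparableClosure (Kinf P)

instance : Field (Ksep P) := inferInstanceAs (Field (SeparableClosure (Kinf P)))

instance : Algebra (Kinf P) (Ksep P) :=
  inferInstanceAs (Algebra (Kinf P) (SeparableClosure (Kinf P)))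

instance : IsSepClosure (Kinf P) (Ksep P) :=
  inferInstanceAs (IsSepClosure (Kinf P) (SeparableClosure (Kinf P)))

instance : Algebra.IsAlgebraic (Kinf P) (Ksep P) :=
  inferInstanceAs (Algebra.IsAlgebraic (Kinf P) (SeparableClosure (Kinf P)))

instance : NontriviallyNormedField (Ksep P) :=
  spectralNorm.nontriviallyNormedField (Kinf P) (Ksep P)

instance : NormedAlgebra (Kinf P) (Ksep P) := spectralNorm.normedAlgebra (Kinf P) (Ksep P)

instance : Algebra K (Ksep P) := ((algebraMap (Kinf P) (Ksep P)).comp (algebraMap K _)).toAlgebra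

instance : Algebra F (Ksep P) := ((algebraMap (Kinf P) (Ksep P)).comp (algebraMap F _)).toAlgebra

instance : IsScalarTower K (Kinf P) (Ksep P) := .of_algebraMap_eq fun _ ↦ rfl
instance : IsScalarTower F (Kinf P) (Ksep P) := .of_algebraMap_eq fun _ ↦ rfl
instance : IsScalarTower F K (Ksep P) := .of_algebraMap_eq fun _ ↦ rfl

/-- The field `ℂ_∞`: the completion of the separable closure of `K_∞`. -/
def Cinf : Type _ := UniformSpace.Completion (Ksep P)

instance : NormedField (Cinf P) := inferInstanceAs (NormedField (UniformSpace.Completion (Ksep P)))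

/-- The inclusion of the separable closure of `K_∞` in `ℂ_∞`. -/
instance : Algebra (Ksep P) (Cinf P) :=
  (UniformSpace.Completion.coeRingHom (α := Ksep P)).toAlgebra

instance : Algebra K (Cinf P) := ((algebraMap (Ksep P) (Cinf P)).comp (algebraMap K _)).toAlgebra

instance : Algebra F (Cinf P) := ((algebraMap (Ksep P) (Cinf P)).comp (algebraMap F _)).toAlgebra

instance : IsScalarTower K (Ksep P) (Cinf P) := .of_algebraMap_eq fun _ ↦ rfl
instance : IsScalarTower F (Ksep P) (Cinf P) := .of_algebraMap_eq fun _ ↦ rfl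
instance : IsScalarTower F K (Cinf P) := .of_algebraMap_eq fun _ ↦ rfl

variable (L : IntermediateField (Kinf P) (Ksep P))

instance : IsScalarTower F K L := .of_algebraMap_eq fun _ ↦ rfl

lemma norm_algebraMap_Cinf (x : Ksep P) : ‖algebraMap (Ksep P) (Cinf P) x‖ = ‖x‖ :=
  UniformSpace.Completion.norm_coe x

variable {P} in
lemma one_lt_norm_Kinf {a : K} (ha : a ∉ P.ring) : 1 < ‖algebraMap K (Kinf P) a‖ := by
  rw [← val_le_one_iff, not_le] at ha
  refine Valued.toNormedField.one_lt_norm_iff.2 ?_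
  have : Valued.v (algebraMap K (Kinf P) a) = val P a :=
    IsDedekindDomain.HeightOneSpectrum.valuedAdicCompletion_eq_valuation' _ a
  rwa [this]

end Fields

section TensorRing

variable {F K : Type*} [Field F] [Field K] [Algebra F K] (P : Place F K)

/-- The ring `A ⊗ R` (tensor product over `F`), for an `F`-algebra `R`. -/
def AT (R : Type*) [CommRing R] [Algebra F R] : Type _ := regularAway P ⊗[F] R

variable (R : Type*) [CommRing R] [Algebra F R]

instance : CommRing (AT P R) := inferInstanceAs (CommRing (regularAway P ⊗[F] R))

instance : Algebra (regularAway P) (AT P R) :=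
  inferInstanceAs (Algebra (regularAway P) (regularAway P ⊗[F] R))

variable {P R}

/-- The pure tensor `a ⊗ c` in `A ⊗ R`. -/
def AT.mk (a : regularAway P) (c : R) : AT P R := a ⊗ₜ[F] c

lemma AT.mk_mul (a b : regularAway P) (c d : R) :
    AT.mk a c * AT.mk b d = AT.mk (a * b) (c * d) :=
  Algebra.TensorProduct.tmul_mul_tmul a b c d

lemma AT.mk_neg (a : regularAway P) (c : R) : AT.mk a (-c) = - AT.mk a c :=
  TensorProduct.tmul_neg a c

lemma AT.one_def : (1 : AT P R) = AT.mk 1 1 := rfl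

lemma AT.zero_mk (c : R) : (AT.mk 0 c : AT P R) = 0 := TensorProduct.zero_tmul _ c

@[elab_as_elim]
lemma AT.induction {p : AT P R → Prop} (x : AT P R) (zero : p 0)
    (mk : ∀ a c, p (AT.mk a c)) (add : ∀ x y, p x → p y → p (x + y)) : p x :=
  TensorProduct.induction_on x zero mk add

variable (P) in
/-- The homomorphism `A ⊗ R → A ⊗ S`, `a ⊗ c ↦ a ⊗ f c`. -/
def AT.map {S : Type*} [CommRing S] [Algebra F S] (f : R →ₐ[F] S) :
    AT P R →ₐ[regularAway P] AT P S :=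
  Algebra.TensorProduct.map (AlgHom.id _ _) f

@[simp]
lemma AT.map_mk {S : Type*} [CommRing S] [Algebra F S] (f : R →ₐ[F] S) (a : regularAway P)
    (c : R) : AT.map P f (AT.mk a c) = AT.mk a (f c) := rfl

variable (P R) in
/-- The endomorphism `τ` of `A ⊗ R`: `a ⊗ c ↦ a ⊗ c ^ q`, where `q = #F`. -/
def tau [Fintype F] : AT P R →ₐ[regularAway P] AT P R :=
  AT.map P (FiniteField.frobeniusAlgHom F R)

@[simp]
lemma tau_mk [Fintype F] (a : regularAway P) (c : R) :
    tau P R (AT.mk a c) = AT.mk a (c ^ Fintype.card F) := rfl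

lemma map_tau [Fintype F] {S : Type*} [CommRing S] [Algebra F S] (f : R →ₐ[F] S) (x : AT P R) :
    AT.map P f (tau P R x) = tau P S (AT.map P f x) := by
  induction x using AT.induction with
  | zero => simp
  | mk a c => simp
  | add x y hx hy => simp [hx, hy]

end TensorRing

section Motives

variable {F K : Type*} [Field F] [Fintype F] [Field K] [Algebra F K] (P : Place F K)

/-- The multiplication map `A ⊗ K → K`, `a ⊗ c ↦ a c`. -/
def mulMap : AT P K →+* K :=
  (Algebra.TensorProduct.productMap (regularAway P).val (AlgHom.id F K)).toRingHom

/-- The ideal `𝔧` of `A ⊗ K`: the kernel of the multiplication map `A ⊗ K → K`. -/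
def jIdeal : Ideal (AT P K) := RingHom.ker (mulMap P)

/-- The ideal `τ^i 𝔧`, generated by the image of `𝔧` under the `i`-th iterate of `τ`. -/
def jTwist (i : ℕ) : Ideal (AT P K) := (jIdeal P).map ((tau P K : AT P K →+* AT P K) ^ i)

/-- The ideal of the effective divisor `J_m = 𝔧 + τ𝔧 + ... + τ^m 𝔧`. -/
def JIdeal (m : ℕ) : Ideal (AT P K) := ∏ i ∈ Finset.range (m + 1), jTwist P i

lemma JIdeal_anti : Antitone (JIdeal P) := by
  refine antitone_nat_of_succ_le fun m ↦ ?_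
  rw [JIdeal, JIdeal, Finset.prod_range_succ _ (m + 1)]
  exact Ideal.mul_le_left

/-- The multiplicative subset of `A ⊗ K` generated by the (nonzero) elements
`a ⊗ 1 - 1 ⊗ a ^ (q ^ i)`, for `a ∈ A` with a pole at `∞`, i.e. `a` nonconstant. Each `τ^i 𝔧`
contains such elements, so that every function whose poles lie on finitely many of the `τ^i 𝔧`
becomes regular after multiplication by an element of this set. -/
def poleSet : Submonoid (AT P K) :=
  Submonoid.closure {b | ∃ a : regularAway P, (a : K) ∉ P.ring ∧ ∃ i : ℕ,
    b = AT.mk a 1 - AT.mk 1 ((a : K) ^ Fintype.card F ^ i)}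

lemma tau_mem_poleSet {b : AT P K} (hb : b ∈ poleSet P) : tau P K b ∈ poleSet P := by
  suffices h : poleSet P ≤ (poleSet P).comap (tau P K) from h hb
  refine Submonoid.closure_le.2 ?_
  rintro _ ⟨a, ha, i, rfl⟩
  refine Submonoid.subset_closure ⟨a, ha, i + 1, ?_⟩
  simp [pow_succ, pow_mul]

/-- The localization of `A ⊗ K` at `poleSet`, a ring of meromorphic functions on
`Spec (A ⊗ K)`. -/
def PoleLoc : Type _ := Localization (poleSet P)

instance : CommRing (PoleLoc P) := inferInstanceAs (CommRing (Localization (poleSet P)))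

instance : Algebra (AT P K) (PoleLoc P) :=
  inferInstanceAs (Algebra (AT P K) (Localization (poleSet P)))

instance : IsLocalization (poleSet P) (PoleLoc P) :=
  inferInstanceAs (IsLocalization (poleSet P) (Localization (poleSet P)))

/-- The ring of functions on the complement of `V(𝔧)` in `Spec (A ⊗ K)`: the fractions `x`
with `𝔧 ^ n • x ⊆ A ⊗ K` for some `n`. -/
def jComplement : Subalgebra (AT P K) (PoleLoc P) where
  carrier := {x | ∃ n : ℕ, ∀ g ∈ jIdeal P ^ n, g • x ∈ (algebraMap (AT P K) (PoleLoc P)).range}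
  mul_mem' := by
    rintro x y ⟨n, hx⟩ ⟨m, hy⟩
    refine ⟨n + m, fun g hg ↦ ?_⟩
    rw [pow_add] at hg
    induction hg using Submodule.mul_induction_on' with
    | mem_mul_mem a ha b hb =>
      have : (a * b) • (x * y) = (a • x) * (b • y) := by
        rw [mul_smul, smul_mul_assoc, mul_smul_comm]
      rw [this]
      exact mul_mem (hx a ha) (hy b hb)
    | add a _ b _ ha hb => rw [add_smul]; exact add_mem ha hb
  add_mem' := by
    rintro x y ⟨n, hx⟩ ⟨m, hy⟩
    refine ⟨n + m, fun g hg ↦ ?_⟩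
    rw [smul_add]
    exact add_mem (hx g (Ideal.pow_le_pow_right (by omega) hg))
      (hy g (Ideal.pow_le_pow_right (by omega) hg))
  algebraMap_mem' b := ⟨0, fun g _ ↦ ⟨g * b, by rw [map_mul, Algebra.smul_def]⟩⟩

/-- The ring `jComplement P`, considered as an algebra over `A ⊗ K` through `τ`. -/
def FrobTwist : Type _ := jComplement P

instance : CommRing (FrobTwist P) := inferInstanceAs (CommRing (jComplement P))

instance : Algebra (jComplement P) (FrobTwist P) :=
  inferInstanceAs (Algebra (jComplement P) (jComplement P))

instance : Algebra (AT P K) (FrobTwist P) :=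
  ((algebraMap (jComplement P) (FrobTwist P)).comp
    ((algebraMap (AT P K) (jComplement P)).comp (tau P K : AT P K →+* AT P K))).toAlgebra

lemma algebraMap_frobTwist (b : AT P K) : algebraMap (AT P K) (FrobTwist P) b =
    algebraMap (jComplement P) (FrobTwist P) (algebraMap (AT P K) (jComplement P) (tau P K b)) := rfl

/-- The structure of an `A`-motive over `K` on a (finite projective) `A ⊗ K`-module `M`: an
isomorphism `τ_M : (τ^* M)|_U ≃ M|_U` over the complement `U` of `V(𝔧)` in `Spec (A ⊗ K)`. -/
structure MotiveStructure (M : Type*) [AddCommGroup M] [Module (AT P K) M] where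
  frob : (FrobTwist P ⊗[AT P K] M) ≃ₗ[jComplement P] (jComplement P ⊗[AT P K] M)

section FixedPoints

variable {P}
variable {M : Type*} [AddCommGroup M] [Module (AT P K) M] (T : MotiveStructure P M)
variable {E : Type*} [CommRing E] [Algebra (AT P K) E]

/-- For a ring `E` over the complement of `V(𝔧)` (through `κ`), the map `m ↦ τ_M(τ^* m)` from `M`
to `E ⊗ M`. -/
def MotiveStructure.frobVec (κ : jComplement P →ₐ[AT P K] E) : M →+ E ⊗[AT P K] M where
  toFun m := LinearMap.rTensor M κ.toLinearMap (T.frob (1 ⊗ₜ m))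
  map_zero' := by simp
  map_add' := by simp [TensorProduct.tmul_add]

lemma MotiveStructure.frobVec_smul (κ : jComplement P →ₐ[AT P K] E) (b : AT P K) (m : M) :
    T.frobVec κ (b • m) = tau P K b • T.frobVec κ m := by
  have h : (1 : FrobTwist P) ⊗ₜ[AT P K] (b • m) =
      (algebraMap (AT P K) (jComplement P) (tau P K b)) • ((1 : FrobTwist P) ⊗ₜ[AT P K] m) := by
    rw [← TensorProduct.smul_tmul, TensorProduct.smul_tmul', Algebra.smul_def, Algebra.smul_def,
      algebraMap_frobTwist]
  simp only [MotiveStructure.frobVec, AddMonoidHom.coe_mk, ZeroHom.coe_mk]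
  rw [h, map_smul, algebraMap_smul, map_smul]

/-- The `τ`-semilinear map `f ↦ τ_M(τ^* f)` on `E ⊗ M`, for an algebra `E` as above with an
endomorphism `σ` compatible with `τ`. -/
def MotiveStructure.act (κ : jComplement P →ₐ[AT P K] E) (σ : E →+* E)
    (hσ : ∀ b, σ (algebraMap (AT P K) E b) = algebraMap (AT P K) E (tau P K b)) :
    E ⊗[AT P K] M →+ E ⊗[AT P K] M :=
  TensorProduct.liftAddHom
    { toFun := fun e ↦ (DistribSMul.toAddMonoidHom (E ⊗[AT P K] M) (σ e)).comp (T.frobVec κ)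
      map_zero' := by ext; simp
      map_add' := fun x y ↦ by ext; simp [add_smul] }
    (fun b e m ↦ by
      simp only [AddMonoidHom.coe_mk, ZeroHom.coe_mk, AddMonoidHom.comp_apply,
        DistribSMul.toAddMonoidHom_apply, T.frobVec_smul]
      rw [Algebra.smul_def, map_mul, hσ, mul_smul, algebraMap_smul, smul_comm])

end FixedPoints
end Motives

section Gauss

variable {F K : Type*} [Field F] [Field K] [Algebra F K] (P : Place F K)
  [IsDiscreteValuationRing P.ring]
variable (L : Type*) [NormedField L] [Algebra F L]

/-- The radii `ρ ∈ |L^×|` with `ρ ≥ 1`. -/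
def Radius : Type := {ρ : ℝ // 1 ≤ ρ ∧ ∃ c : L, ‖c‖ = ρ}

instance : LE (Radius L) := ⟨fun ρ ρ' ↦ ρ.1 ≤ ρ'.1⟩

instance : One (Radius L) := ⟨⟨1, le_rfl, 1, norm_one⟩⟩

variable {L}

/-- The elements of `A ⊗ L` which are finite sums of tensors `a ⊗ ℓ` with `|ℓ| ρ ^ (deg a) ≤ r`. -/
def gaussBall (ρ : Radius L) (r : ℝ) : AddSubgroup (AT P L) :=
  AddSubgroup.closure {f | ∃ (a : regularAway P) (l : L), a ≠ 0 ∧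
    ‖l‖ * ρ.1 ^ deg P (a : K) ≤ r ∧ f = AT.mk a l}

/-- The Gauss norm `‖f‖_ρ` on `A ⊗ L`: the infimum of `max_i |ℓ_i| ρ ^ (deg a_i)` over all
representations `f = ∑ i, a_i ⊗ ℓ_i`. -/
def gaussNorm (ρ : Radius L) (f : AT P L) : ℝ := sInf {r : ℝ | 0 ≤ r ∧ f ∈ gaussBall P ρ r}

variable {P}

lemma gaussBall_mono (ρ : Radius L) : Monotone (gaussBall P ρ) := by
  intro r s hrs
  refine AddSubgroup.closure_mono ?_
  rintro f ⟨a, l, ha, h, rfl⟩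
  exact ⟨a, l, ha, h.trans hrs, rfl⟩

lemma exists_mem_gaussBall (ρ : Radius L) (f : AT P L) : ∃ r, 0 ≤ r ∧ f ∈ gaussBall P ρ r := by
  induction f using AT.induction with
  | zero => exact ⟨0, le_rfl, zero_mem _⟩
  | mk a c =>
    by_cases ha : a = 0
    · subst ha; exact ⟨0, le_rfl, by rw [AT.zero_mk]; exact zero_mem _⟩
    · have := ρ.2.1
      exact ⟨‖c‖ * ρ.1 ^ deg P (a : K), by positivity,
        AddSubgroup.subset_closure ⟨a, c, ha, le_rfl, rfl⟩⟩
  | add x y hx hy =>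
    obtain ⟨r, hr, hx⟩ := hx
    obtain ⟨s, hs, hy⟩ := hy
    exact ⟨max r s, hr.trans (le_max_left _ _), add_mem
      (gaussBall_mono ρ (le_max_left _ _) hx) (gaussBall_mono ρ (le_max_right _ _) hy)⟩

lemma gaussNorm_nonneg (ρ : Radius L) (f : AT P L) : 0 ≤ gaussNorm P ρ f :=
  Real.sInf_nonneg fun _ h ↦ h.1

lemma gaussNorm_le {ρ : Radius L} {f : AT P L} {r : ℝ} (hr : 0 ≤ r) (h : f ∈ gaussBall P ρ r) :
    gaussNorm P ρ f ≤ r := csInf_le ⟨0, fun _ h ↦ h.1⟩ ⟨hr, h⟩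

lemma mem_gaussBall_of_lt {ρ : Radius L} {f : AT P L} {r : ℝ} (h : gaussNorm P ρ f < r) :
    f ∈ gaussBall P ρ r := by
  obtain ⟨r₀, hr₀, hf⟩ := exists_mem_gaussBall ρ f
  have hne : {r : ℝ | 0 ≤ r ∧ f ∈ gaussBall P ρ r}.Nonempty := ⟨r₀, hr₀, hf⟩
  obtain ⟨s, ⟨-, hs⟩, hsr⟩ := exists_lt_of_csInf_lt hne h
  exact gaussBall_mono ρ hsr.le hs

lemma mul_mem_gaussBall {ρ : Radius L} {f g : AT P L} {r s : ℝ} (hr : 0 ≤ r)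
    (hf : f ∈ gaussBall P ρ r) (hg : g ∈ gaussBall P ρ s) : f * g ∈ gaussBall P ρ (r * s) := by
  have hρ : 0 < ρ.1 := one_pos.trans_le ρ.2.1
  refine AddSubgroup.closure_induction ?_ ?_ ?_ ?_ hf
  · rintro _ ⟨a, l, ha, hl, rfl⟩
    refine AddSubgroup.closure_induction ?_ ?_ ?_ ?_ hg
    · rintro _ ⟨b, m, hb, hm, rfl⟩
      refine AddSubgroup.subset_closure ⟨a * b, l * m, mul_ne_zero ha hb, ?_, AT.mk_mul ..⟩
      have ha' : (a : K) ≠ 0 := by simpa using ha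
      have hb' : (b : K) ≠ 0 := by simpa using hb
      rw [MulMemClass.coe_mul, deg_mul ha' hb', zpow_add₀ hρ.ne', norm_mul]
      calc _ = (‖l‖ * ρ.1 ^ deg P (a : K)) * (‖m‖ * ρ.1 ^ deg P (b : K)) := by ring
        _ ≤ r * s := mul_le_mul hl hm (by positivity) hr
    · simp
    · intro x y _ _ hx hy; rw [mul_add]; exact add_mem hx hy
    · intro x _ hx; rw [mul_neg]; exact neg_mem hx
  · simp
  · intro x y _ _ hx hy; rw [add_mul]; exact add_mem hx hy
  · intro x _ hx; rw [neg_mul]; exact neg_mem hx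

variable (P) in
/-- The Gauss norm `‖·‖_ρ`, as a submultiplicative seminorm on the ring `A ⊗ L`. -/
def gaussSeminorm (ρ : Radius L) : RingSeminorm (AT P L) where
  toFun := gaussNorm P ρ
  map_zero' := le_antisymm (gaussNorm_le le_rfl (zero_mem _)) (gaussNorm_nonneg _ _)
  add_le' f g := by
    refine le_of_forall_pos_le_add fun ε hε ↦ ?_
    have hf := gaussNorm_nonneg ρ f
    have hg := gaussNorm_nonneg ρ g
    refine gaussNorm_le (by positivity) (add_mem ?_ ?_)
    · exact mem_gaussBall_of_lt (by linarith)
    · exact mem_gaussBall_of_lt (by linarith)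
  neg' f := by
    have h : ∀ g : AT P L, gaussNorm P ρ (-g) ≤ gaussNorm P ρ g := fun g ↦ by
      refine le_of_forall_pos_le_add fun ε hε ↦ gaussNorm_le ?_ ?_
      · have := gaussNorm_nonneg ρ g; positivity
      · exact neg_mem (mem_gaussBall_of_lt (by linarith))
    exact le_antisymm (h f) (by simpa using h (-f))
  mul_le' f g := by
    have hf := gaussNorm_nonneg ρ f
    have hg := gaussNorm_nonneg ρ g
    have key : ∀ ε : ℝ, 0 < ε → gaussNorm P ρ (f * g) ≤
        (gaussNorm P ρ f + ε) * (gaussNorm P ρ g + ε) := fun ε hε ↦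
      gaussNorm_le (by positivity) (mul_mem_gaussBall (by positivity)
        (mem_gaussBall_of_lt (by linarith)) (mem_gaussBall_of_lt (by linarith)))
    have hc : Continuous fun ε ↦ (gaussNorm P ρ f + ε) * (gaussNorm P ρ g + ε) := by fun_prop
    have ht : Filter.Tendsto (fun ε ↦ (gaussNorm P ρ f + ε) * (gaussNorm P ρ g + ε))
        (nhdsWithin (0 : ℝ) (Set.Ioi 0)) (nhds (gaussNorm P ρ f * gaussNorm P ρ g)) := by
      simpa using (hc.tendsto 0).mono_left nhdsWithin_le_nhds
    exact ge_of_tendsto ht (eventually_mem_nhdsWithin.mono fun ε hε ↦ key ε hε)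

variable (P) in
/-- The ring `A ⊗ L`, endowed with the Gauss norm `‖·‖_ρ`. -/
def GaussRing (_ : Radius L) : Type _ := AT P L

instance (ρ : Radius L) : SeminormedCommRing (GaussRing P ρ) :=
  { (gaussSeminorm P ρ).toSeminormedRing with mul_comm := mul_comm (G := AT P L) }

/-- The identity map from `A ⊗ L` to the same ring with its Gauss norm. -/
def GaussRing.equiv (ρ : Radius L) : AT P L ≃+* GaussRing P ρ where
  toFun x := x
  invFun x := x
  left_inv _ := rfl
  right_inv _ := rfl
  map_mul' _ _ := rfl
  map_add' _ _ := rfl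

lemma GaussRing.norm_def {ρ : Radius L} (f : AT P L) :
    ‖GaussRing.equiv ρ f‖ = gaussNorm P ρ f := rfl

/-- A ring homomorphism `A ⊗ L → A ⊗ L'`, seen between these rings with Gauss norms. -/
def GaussRing.hom {L' : Type*} [NormedField L'] [Algebra F L'] (ρ : Radius L) (ρ' : Radius L')
    (φ : AT P L →+* AT P L') : GaussRing P ρ →+* GaussRing P ρ' :=
  ((GaussRing.equiv ρ').toRingHom.comp φ).comp (GaussRing.equiv ρ).symm.toRingHom

lemma GaussRing.continuous_hom {L' : Type*} [NormedField L'] [Algebra F L'] {ρ : Radius L}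
    {ρ' : Radius L'} (φ : AT P L →+* AT P L')
    (h : ∀ r : ℝ, 0 ≤ r → r ≤ 1 → ∀ (a : regularAway P) (l : L), a ≠ 0 →
      ‖l‖ * ρ.1 ^ deg P (a : K) ≤ r → φ (AT.mk a l) ∈ gaussBall P ρ' r) :
    Continuous (GaussRing.hom ρ ρ' φ) := by
  refine continuous_of_continuousAt_zero (GaussRing.hom ρ ρ' φ) ?_
  rw [Metric.continuousAt_iff]
  intro ε hε
  refine ⟨min (ε / 2) 1, by positivity, fun {x} hx ↦ ?_⟩
  rw [map_zero, dist_zero_right]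
  rw [dist_zero_right] at hx
  obtain ⟨x, rfl⟩ := (GaussRing.equiv ρ).surjective x
  rw [GaussRing.norm_def] at hx
  have hmem := mem_gaussBall_of_lt hx
  have hpos : (0 : ℝ) ≤ min (ε / 2) 1 := by positivity
  have : φ x ∈ gaussBall P ρ' (min (ε / 2) 1) := by
    refine AddSubgroup.closure_induction
      (p := fun y _ ↦ φ y ∈ gaussBall P ρ' (min (ε / 2) 1)) ?_ ?_ ?_ ?_ hmem
    · rintro _ ⟨a, l, ha, hl, rfl⟩
      exact h _ hpos (min_le_right _ _) a l ha hl
    · rw [map_zero]; exact zero_mem _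
    · intro x y _ _ hx hy
      rw [map_add]; exact add_mem hx hy
    · intro x _ hx
      rw [map_neg]; exact neg_mem hx
  calc gaussNorm P ρ' (φ x) ≤ min (ε / 2) 1 := gaussNorm_le hpos this
    _ ≤ ε / 2 := min_le_left _ _
    _ < ε := by linarith

variable (P) in
/-- The affinoid algebra `L⟨A⟩_ρ`: the completion of `A ⊗ L` for the Gauss norm `‖·‖_ρ`. For
`ρ = 1` this is the Tate algebra `L⟨A⟩`. -/
def Tate (ρ : Radius L) : Type _ := UniformSpace.Completion (GaussRing P ρ)

instance (ρ : Radius L) : NormedCommRing (Tate P ρ) :=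
  inferInstanceAs (NormedCommRing (UniformSpace.Completion (GaussRing P ρ)))

instance (ρ : Radius L) : CompleteSpace (Tate P ρ) :=
  inferInstanceAs (CompleteSpace (UniformSpace.Completion (GaussRing P ρ)))

/-- The canonical map `A ⊗ L → L⟨A⟩_ρ`. -/
def Tate.of (ρ : Radius L) : AT P L →+* Tate P ρ :=
  (UniformSpace.Completion.coeRingHom : GaussRing P ρ →+* _).comp (GaussRing.equiv ρ).toRingHom

/-- The continuous extension `L⟨A⟩_ρ → L'⟨A⟩_ρ'` of a continuous homomorphism. -/
def Tate.map {L' : Type*} [NormedField L'] [Algebra F L'] {ρ : Radius L} {ρ' : Radius L'}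
    (φ : AT P L →+* AT P L') (h : Continuous (GaussRing.hom ρ ρ' φ)) : Tate P ρ →+* Tate P ρ' :=
  UniformSpace.Completion.mapRingHom _ h

lemma Tate.map_of {L' : Type*} [NormedField L'] [Algebra F L'] {ρ : Radius L} {ρ' : Radius L'}
    (φ : AT P L →+* AT P L') (h : Continuous (GaussRing.hom ρ ρ' φ)) (x : AT P L) :
    Tate.map φ h (Tate.of ρ x) = Tate.of ρ' (φ x) :=
  UniformSpace.Completion.mapRingHom_coe h _

lemma norm_tate_of (ρ : Radius L) (x : AT P L) : ‖Tate.of ρ x‖ = gaussNorm P ρ x :=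
  UniformSpace.Completion.norm_coe (GaussRing.equiv ρ x)

lemma continuous_id_gauss [Fintype F] {ρ ρ' : Radius L} (h : ρ ≤ ρ') :
    Continuous (GaussRing.hom ρ' ρ (RingHom.id (AT P L))) := by
  refine GaussRing.continuous_hom _ fun r _ _ a l ha hl ↦ ?_
  have ha' : (a : K) ≠ 0 := by simpa using ha
  refine AddSubgroup.subset_closure ⟨a, l, ha, le_trans ?_ hl, rfl⟩
  lift deg P (a : K) to ℕ using deg_nonneg a.2 ha' with d
  have := ρ.2.1
  have h' : ρ.1 ≤ ρ'.1 := h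
  simp only [zpow_natCast]
  gcongr

lemma continuous_tau [Fintype F] (ρ : Radius L) :
    Continuous (GaussRing.hom ρ ρ (tau P L : AT P L →+* AT P L)) := by
  refine GaussRing.continuous_hom _ fun r hr0 hr1 a l ha hl ↦ ?_
  have ha' : (a : K) ≠ 0 := by simpa using ha
  refine AddSubgroup.subset_closure ⟨a, l ^ Fintype.card F, ha, ?_, rfl⟩
  lift deg P (a : K) to ℕ using deg_nonneg a.2 ha' with d
  have h1 : 1 ≤ ρ.1 ^ d := one_le_pow₀ ρ.2.1
  have hq : Fintype.card F ≠ 0 := Fintype.card_ne_zero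
  simp only [zpow_natCast] at hl ⊢
  calc ‖l ^ Fintype.card F‖ * ρ.1 ^ d ≤ ‖l‖ ^ Fintype.card F * (ρ.1 ^ d) ^ Fintype.card F := by
        rw [norm_pow]; gcongr; exact le_self_pow₀ h1 hq
    _ = (‖l‖ * ρ.1 ^ d) ^ Fintype.card F := (mul_pow _ _ _).symm
    _ ≤ r ^ Fintype.card F := by gcongr
    _ ≤ r := pow_le_of_le_one hr0 hr1 hq

lemma continuous_baseChange {L' : Type*} [NormedField L'] [Algebra F L'] (f : L →ₐ[F] L')
    (hf : ∀ x, ‖f x‖ = ‖x‖) :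
    Continuous
      (GaussRing.hom (1 : Radius L) (1 : Radius L') (AT.map P f : AT P L →+* AT P L')) := by
  refine GaussRing.continuous_hom _ fun r _ _ a l ha hl ↦ ?_
  exact AddSubgroup.subset_closure ⟨a, f l, ha, by rw [hf]; exact hl, rfl⟩

end Gauss

section Analytic

variable {F K : Type*} [Field F] [Fintype F] [Field K] [Algebra F K] {P : Place F K}
  [IsDiscreteValuationRing P.ring]
variable {L : Type*} [NormedField L] [Algebra F L] [Algebra K L] [IsScalarTower F K L]

instance (ρ : Radius L) : Algebra (AT P K) (Tate P ρ) :=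
  ((Tate.of ρ).comp (AT.map P (IsScalarTower.toAlgHom F K L) : AT P K →+* AT P L)).toAlgebra

instance (ρ : Radius L) : Algebra (regularAway P) (Tate P ρ) :=
  ((algebraMap (AT P K) (Tate P ρ)).comp (algebraMap (regularAway P) (AT P K))).toAlgebra

instance (ρ : Radius L) : IsScalarTower (regularAway P) (AT P K) (Tate P ρ) :=
  .of_algebraMap_eq fun _ ↦ rfl

lemma algebraMap_tate (ρ : Radius L) (b : AT P K) : algebraMap (AT P K) (Tate P ρ) b =
    Tate.of ρ (AT.map P (IsScalarTower.toAlgHom F K L) b) := rfl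

/-- The continuous extension of `τ` to `L⟨A⟩_ρ`. -/
def Tate.tau (ρ : Radius L) : Tate P ρ →+* Tate P ρ :=
  Tate.map (AMotive.tau P L : AT P L →+* AT P L) (continuous_tau ρ)

lemma Tate.tau_algebraMap (ρ : Radius L) (b : AT P K) :
    Tate.tau ρ (algebraMap (AT P K) (Tate P ρ) b) =
      algebraMap (AT P K) (Tate P ρ) (AMotive.tau P K b) := by
  rw [algebraMap_tate, algebraMap_tate, map_tau]
  exact Tate.map_of _ _ _

/-- The canonical map `L⟨A⟩_ρ' → L⟨A⟩_ρ` for `ρ ≤ ρ'`. -/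
def Tate.restrict {ρ ρ' : Radius L} (h : ρ ≤ ρ') : Tate P ρ' →ₐ[AT P K] Tate P ρ where
  toRingHom := Tate.map (RingHom.id (AT P L)) (continuous_id_gauss h)
  commutes' _ := Tate.map_of _ _ _

/-- The canonical map `L⟨A⟩ → L'⟨A⟩` for an extension `L'` of `L` of normed fields. -/
def Tate.baseChange {L' : Type*} [NormedField L'] [Algebra F L'] [Algebra K L']
    [IsScalarTower F K L'] (f : L →ₐ[K] L') (hf : ∀ x, ‖f x‖ = ‖x‖) :
    Tate P (1 : Radius L) →ₐ[AT P K] Tate P (1 : Radius L') where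
  toRingHom := Tate.map (AT.map P (f.restrictScalars F) : AT P L →+* AT P L')
    (continuous_baseChange (f.restrictScalars F) hf)
  commutes' b := by
    refine (Tate.map_of _ _ _).trans ?_
    rw [algebraMap_tate]
    congr 1
    induction b using AT.induction with
    | zero => simp
    | mk a c => simp
    | add x y hx hy => simp only [map_add, hx, hy]

/-- The elements of `poleSet` are invertible in the algebra `E` over `A ⊗ K`. -/
class PolesInvertible (P : Place F K) (E : Type*) [CommRing E] [Algebra (AT P K) E] : Prop where
  isUnit : ∀ s ∈ poleSet P, IsUnit (algebraMap (AT P K) E s)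

/-- `L` is a normed extension of `K` in which the elements with a pole at `∞` have absolute value
greater than one. -/
class IsNormedOver (P : Place F K) (L : Type*) [NormedField L] [Algebra K L] : Prop where
  one_lt_norm : ∀ a : K, a ∉ P.ring → 1 < ‖algebraMap K L a‖

instance [IsNormedOver P L] : PolesInvertible P (Tate P (1 : Radius L)) where
  isUnit s hs := by
    suffices h : poleSet P ≤ (IsUnit.submonoid (Tate P (1 : Radius L))).comap
        (algebraMap (AT P K) (Tate P (1 : Radius L))) from h hs
    refine Submonoid.closure_le.2 ?_
    rintro _ ⟨a, ha, i, rfl⟩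
    change IsUnit _
    set c : L := (algebraMap K L a) ^ Fintype.card F ^ i with hc
    have hc1 : 1 < ‖c‖ := by
      rw [hc, norm_pow]
      exact one_lt_pow₀ (IsNormedOver.one_lt_norm (P := P) _ ha)
        (pow_ne_zero _ Fintype.card_ne_zero)
    have hc0 : c ≠ 0 := by rintro h; rw [h, norm_zero] at hc1; linarith
    have ha0 : a ≠ 0 := by rintro rfl; exact ha (zero_mem _)
    have key : algebraMap (AT P K) (Tate P (1 : Radius L))
        (AT.mk a 1 - AT.mk 1 ((a : K) ^ Fintype.card F ^ i)) =
        - (Tate.of 1 (AT.mk 1 c) * (1 - Tate.of 1 (AT.mk a c⁻¹))) := by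
      rw [algebraMap_tate, mul_sub, mul_one, ← map_mul, AT.mk_mul, one_mul,
        mul_inv_cancel₀ hc0, ← map_sub, ← map_neg, map_sub]
      simp [hc]
    rw [key]
    refine (IsUnit.mul ?_ (isUnit_one_sub_of_norm_lt_one ?_)).neg
    · refine IsUnit.map _ (IsUnit.of_mul_eq_one (AT.mk 1 c⁻¹) ?_)
      rw [AT.mk_mul, mul_inv_cancel₀ hc0, one_mul]; rfl
    · rw [norm_tate_of]
      refine (gaussNorm_le (norm_nonneg c⁻¹) ?_).trans_lt ?_
      · refine AddSubgroup.subset_closure ⟨a, c⁻¹, ha0, ?_, rfl⟩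
        rw [show (1 : Radius L).1 = 1 from rfl, one_zpow, mul_one]
      · rw [norm_inv]; exact inv_lt_one_of_one_lt₀ hc1

/-- The structure map `𝒪(U) → E` for an algebra `E` in which the poles are invertible, where `U`
is the complement of `V(𝔧)`. -/
def kappa (P : Place F K) (E : Type*) [CommRing E] [Algebra (AT P K) E] [h : PolesInvertible P E] :
    jComplement P →ₐ[AT P K] E :=
  (IsLocalization.liftAlgHom (M := poleSet P) (S := PoleLoc P) (f := Algebra.ofId (AT P K) E)
    fun s ↦ h.isUnit s s.2).comp (jComplement P).val

variable (P) in
/-- The ring of meromorphic functions on `𝔛_ρ = Sp L⟨A⟩_ρ` which become regular after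
multiplication by an element of `poleSet`. -/
def Mer (ρ : Radius L) : Type _ :=
  Localization (Algebra.algebraMapSubmonoid (Tate P ρ) (poleSet P))

instance (ρ : Radius L) : CommRing (Mer P ρ) := inferInstanceAs
  (CommRing (Localization (Algebra.algebraMapSubmonoid (Tate P ρ) (poleSet P))))

instance (ρ : Radius L) : Algebra (Tate P ρ) (Mer P ρ) := inferInstanceAs
  (Algebra (Tate P ρ) (Localization (Algebra.algebraMapSubmonoid (Tate P ρ) (poleSet P))))

instance (ρ : Radius L) :
    IsLocalization (Algebra.algebraMapSubmonoid (Tate P ρ) (poleSet P)) (Mer P ρ) :=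
  inferInstanceAs (IsLocalization (Algebra.algebraMapSubmonoid (Tate P ρ) (poleSet P))
    (Localization (Algebra.algebraMapSubmonoid (Tate P ρ) (poleSet P))))

instance (ρ : Radius L) : Algebra (AT P K) (Mer P ρ) :=
  ((algebraMap (Tate P ρ) (Mer P ρ)).comp (algebraMap (AT P K) (Tate P ρ))).toAlgebra

instance (ρ : Radius L) : IsScalarTower (AT P K) (Tate P ρ) (Mer P ρ) :=
  .of_algebraMap_eq fun _ ↦ rfl

instance (ρ : Radius L) : Algebra (regularAway P) (Mer P ρ) :=
  ((algebraMap (AT P K) (Mer P ρ)).comp (algebraMap (regularAway P) (AT P K))).toAlgebra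

instance (ρ : Radius L) : IsScalarTower (regularAway P) (AT P K) (Mer P ρ) :=
  .of_algebraMap_eq fun _ ↦ rfl

instance (ρ : Radius L) : PolesInvertible P (Mer P ρ) where
  isUnit s hs := IsLocalization.map_units (Mer P ρ)
    (⟨_, Algebra.mem_algebraMapSubmonoid_of_mem ⟨s, hs⟩⟩ :
      Algebra.algebraMapSubmonoid (Tate P ρ) (poleSet P))

/-- The extension of `τ` to meromorphic functions on `𝔛_ρ`. -/
def Mer.tau (ρ : Radius L) : Mer P ρ →+* Mer P ρ :=
  IsLocalization.map (M := Algebra.algebraMapSubmonoid (Tate P ρ) (poleSet P))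
    (T := Algebra.algebraMapSubmonoid (Tate P ρ) (poleSet P)) (Mer P ρ) (Tate.tau ρ) (by
      rintro _ ⟨s, hs, rfl⟩
      exact ⟨_, tau_mem_poleSet P hs, (Tate.tau_algebraMap ρ s).symm⟩)

lemma Mer.tau_algebraMap (ρ : Radius L) (b : AT P K) :
    Mer.tau ρ (algebraMap (AT P K) (Mer P ρ) b) =
      algebraMap (AT P K) (Mer P ρ) (AMotive.tau P K b) := by
  rw [IsScalarTower.algebraMap_apply _ (Tate P ρ), Mer.tau, IsLocalization.map_eq,
    Tate.tau_algebraMap, ← IsScalarTower.algebraMap_apply]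

/-- The restriction of meromorphic functions from `𝔛_ρ'` to `𝔛_ρ`, for `ρ ≤ ρ'`. -/
def Mer.restrict {ρ ρ' : Radius L} (h : ρ ≤ ρ') : Mer P ρ' →ₐ[AT P K] Mer P ρ where
  toRingHom := IsLocalization.map (M := Algebra.algebraMapSubmonoid (Tate P ρ') (poleSet P))
    (T := Algebra.algebraMapSubmonoid (Tate P ρ) (poleSet P)) (Mer P ρ)
    (Tate.restrict (P := P) h).toRingHom (by
      rintro _ ⟨s, hs, rfl⟩
      exact ⟨s, hs, ((Tate.restrict (P := P) h).commutes s).symm⟩)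
  commutes' b := (IsLocalization.map_eq _ _).trans
    (congrArg (algebraMap (Tate P ρ) (Mer P ρ)) ((Tate.restrict h).commutes b))

/-- The sections over `𝔛_ρ` of the sheaf `𝒪(n · J) = colim_m 𝒪(n · J_m)`: those meromorphic
functions `f` with `I_m ^ n · f ⊆ L⟨A⟩_ρ` for some `m`, where `I_m` is the ideal of `J_m`. -/
def sectionsOn (n : ℕ) (ρ : Radius L) : Submodule (AT P K) (Mer P ρ) where
  carrier := {f | ∃ m : ℕ, ∀ g ∈ JIdeal P m ^ n, g • f ∈ (algebraMap (Tate P ρ) (Mer P ρ)).range}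
  zero_mem' := ⟨0, fun g _ ↦ by rw [smul_zero]; exact zero_mem _⟩
  add_mem' := by
    rintro x y ⟨m, hx⟩ ⟨m', hy⟩
    refine ⟨max m m', fun g hg ↦ ?_⟩
    rw [smul_add]
    exact add_mem (hx g (Ideal.pow_right_mono (JIdeal_anti P (le_max_left _ _)) n hg))
      (hy g (Ideal.pow_right_mono (JIdeal_anti P (le_max_right _ _)) n hg))
  smul_mem' b := by
    rintro x ⟨m, hx⟩
    refine ⟨m, fun g hg ↦ ?_⟩
    rw [smul_smul, mul_comm, mul_smul]
    obtain ⟨y, hy⟩ := hx g hg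
    exact ⟨algebraMap _ _ b * y, by rw [map_mul, hy, ← IsScalarTower.algebraMap_apply,
      Algebra.smul_def b]⟩

variable (P L) in
/-- The module `𝒪_𝔛(n · J)(𝔛_L)` of global sections on the rigid analytification
`𝔛_L = ⋃_ρ 𝔛_ρ` of `Spec (A ⊗ L)`: compatible families of sections over the `𝔛_ρ`. -/
def globalSections (n : ℕ) : Submodule (AT P K) (∀ ρ : Radius L, Mer P ρ) where
  carrier := {f | (∀ ρ, f ρ ∈ sectionsOn n ρ) ∧
    ∀ (ρ ρ' : Radius L) (h : ρ ≤ ρ'), Mer.restrict h (f ρ') = f ρ}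
  zero_mem' := ⟨fun _ ↦ zero_mem _, fun _ _ _ ↦ map_zero _⟩
  add_mem' hf hg := ⟨fun ρ ↦ add_mem (hf.1 ρ) (hg.1 ρ), fun ρ ρ' h ↦ by
    rw [Pi.add_apply, map_add, hf.2 ρ ρ' h, hg.2 ρ ρ' h]; rfl⟩
  smul_mem' b f hf := ⟨fun ρ ↦ Submodule.smul_mem _ b (hf.1 ρ), fun ρ ρ' h ↦ by
    rw [Pi.smul_apply, map_smul, hf.2 ρ ρ' h]; rfl⟩

/-- The value on `𝔛_ρ` of a global section of `𝒪_𝔛(n · J)`. -/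
def globalSections.eval (n : ℕ) (ρ : Radius L) : globalSections P L n →ₗ[AT P K] Mer P ρ :=
  (LinearMap.proj ρ).comp (globalSections P L n).subtype

/-- On `Sp L⟨A⟩ = 𝔛_1` all poles are invertible, so that `L⟨A⟩` is its own localization. -/
def tateEquivMer [IsNormedOver P L] : Tate P (1 : Radius L) ≃ₗ[AT P K] Mer P (1 : Radius L) :=
  ((IsLocalization.atUnits (Tate P (1 : Radius L))
    (Algebra.algebraMapSubmonoid (Tate P (1 : Radius L)) (poleSet P))
    (S := Mer P (1 : Radius L)) (by
      rintro _ ⟨s, hs, rfl⟩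
      exact PolesInvertible.isUnit s hs)).restrictScalars (AT P K)).toLinearEquiv

/-- The restriction map `𝒪_𝔛(n · J)(𝔛_L) → 𝒪_𝔛(n · J)(Sp L⟨A⟩) = L⟨A⟩`. -/
def globalSections.toTate [IsNormedOver P L] (n : ℕ) :
    globalSections P L n →ₗ[AT P K] Tate P (1 : Radius L) :=
  tateEquivMer.symm.toLinearMap.comp (globalSections.eval n 1)

section Motive

variable {M : Type*} [AddCommGroup M] [Module (AT P K) M] (T : MotiveStructure P M)

lemma MotiveStructure.act_smul {E : Type*} [CommRing E] [Algebra (AT P K) E]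
    (κ : jComplement P →ₐ[AT P K] E) (σ : E →+* E)
    (hσ : ∀ b, σ (algebraMap (AT P K) E b) = algebraMap (AT P K) E (tau P K b))
    (b : AT P K) (x : E ⊗[AT P K] M) :
    T.act κ σ hσ (b • x) = tau P K b • T.act κ σ hσ x := by
  induction x using TensorProduct.induction_on with
  | zero => simp
  | add x y hx hy => simp [hx, hy]
  | tmul e m =>
    rw [TensorProduct.smul_tmul']
    simp only [MotiveStructure.act, TensorProduct.liftAddHom_tmul, AddMonoidHom.coe_mk,
      ZeroHom.coe_mk, AddMonoidHom.comp_apply, DistribSMul.toAddMonoidHom_apply]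
    rw [Algebra.smul_def, map_mul, hσ, mul_smul, algebraMap_smul]

variable (P L) in
/-- The semilinear map `f ↦ τ_M(τ^* f)` on `L⟨A⟩ ⊗ M`. -/
def MotiveStructure.tateAct [IsNormedOver P L] :
    Tate P (1 : Radius L) ⊗[AT P K] M →+ Tate P (1 : Radius L) ⊗[AT P K] M :=
  T.act (kappa P _) (Tate.tau 1) (Tate.tau_algebraMap 1)

/-- The semilinear map `f ↦ τ_M(τ^* f)` on meromorphic functions on `𝔛_ρ` with values in `M`. -/
def MotiveStructure.merAct (ρ : Radius L) : Mer P ρ ⊗[AT P K] M →+ Mer P ρ ⊗[AT P K] M :=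
  T.act (kappa P _) (Mer.tau ρ) (Mer.tau_algebraMap ρ)

variable (L) in
/-- The `A`-module `(M ⊗ L⟨A⟩)^{τ_M = 1}`. -/
def MotiveStructure.tateFixed [IsNormedOver P L] :
    Submodule (regularAway P) (Tate P (1 : Radius L) ⊗[AT P K] M) where
  carrier := {x | T.tateAct P L x = x}
  zero_mem' := map_zero _
  add_mem' {x y} hx hy := by
    rw [Set.mem_ofPred_eq] at hx hy ⊢
    rw [map_add, hx, hy]
  smul_mem' a x hx := by
    rw [Set.mem_ofPred_eq] at hx ⊢
    rw [← algebraMap_smul (AT P K) a x, MotiveStructure.tateAct, MotiveStructure.act_smul,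
      AlgHom.commutes]
    exact congrArg _ hx

variable (L) in
/-- The `A`-module `(M ⊗ 𝒪_𝔛(n · J)(𝔛_L))^{τ_M = 1}`. The equation `τ_M(τ^* f) = f` is an equality
of meromorphic functions on `𝔛_L` with values in `M`, i.e. an equality on every `𝔛_ρ`. -/
def MotiveStructure.globalFixed (n : ℕ) :
    Submodule (regularAway P) (globalSections P L n ⊗[AT P K] M) where
  carrier := {x | ∀ ρ, T.merAct ρ ((globalSections.eval n ρ).rTensor M x) =
    (globalSections.eval n ρ).rTensor M x}
  zero_mem' := fun ρ ↦ by simp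
  add_mem' {x y} hx hy := fun ρ ↦ by rw [map_add, map_add, hx ρ, hy ρ]
  smul_mem' a x hx := fun ρ ↦ by
    rw [← algebraMap_smul (AT P K) a x, map_smul, MotiveStructure.merAct,
      MotiveStructure.act_smul, AlgHom.commutes]
    exact congrArg _ (hx ρ)

end Motive

end Analytic

section Betti

variable {F K : Type*} [Field F] [Fintype F] [Field K] [Algebra F K] {P : Place F K}
  [IsDiscreteValuationRing P.ring]

instance (L : IntermediateField (Kinf P) (Ksep P)) : IsNormedOver P L where
  one_lt_norm a ha := by
    have h1 := one_lt_norm_Kinf ha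
    have h2 : ‖algebraMap (Kinf P) (Ksep P) (algebraMap K (Kinf P) a)‖ = _ :=
      norm_algebraMap' (Ksep P) _
    rw [← h2] at h1
    exact h1

instance : IsNormedOver P (Cinf P) where
  one_lt_norm a ha := by
    have h1 := one_lt_norm_Kinf ha
    rw [← norm_algebraMap' (Ksep P), ← norm_algebraMap_Cinf] at h1
    exact h1

/-- The inclusion of a subextension `L` of `K_∞^s / K_∞` in `ℂ_∞`. -/
def inclCinf (L : IntermediateField (Kinf P) (Ksep P)) : L →ₐ[K] Cinf P :=
  (IsScalarTower.toAlgHom K (Ksep P) (Cinf P)).comp (L.val.restrictScalars K)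

/-- The inclusion `L⟨A⟩ → ℂ_∞⟨A⟩`. -/
def Tate.toCinf (L : IntermediateField (Kinf P) (Ksep P)) :
    Tate P (1 : Radius L) →ₐ[AT P K] Tate P (1 : Radius (Cinf P)) :=
  Tate.baseChange (inclCinf L) fun x ↦ norm_algebraMap_Cinf P (x : Ksep P)

variable {M : Type*} [AddCommGroup M] [Module (AT P K) M] (T : MotiveStructure P M)

/-- The Betti realization `M_B = {ω ∈ M ⊗ ℂ_∞⟨A⟩ | ω = τ_M(τ^* ω)}`. -/
def MotiveStructure.betti :
    Submodule (regularAway P) (Tate P (1 : Radius (Cinf P)) ⊗[AT P K] M) :=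
  T.tateFixed (Cinf P)

/-- Rigid analytic triviality: the multiplication map
`ℂ_∞⟨A⟩ ⊗_A M_B → M ⊗ ℂ_∞⟨A⟩` is bijective. -/
def MotiveStructure.IsRigidAnalyticallyTrivial : Prop :=
  Function.Bijective (T.betti.subtype.liftBaseChange (Tate P (1 : Radius (Cinf P))))

end Betti

end AMotive

end

noncomputable section

/-! Choose generators of the finite projective module $M$ with dual coordinates. A solution of
$\tau_M(\tau^*f)=f$ over $L\langle A\rangle$ then becomes a vector with $f=\Phi\cdot\tau(f)$, where
the entries of $\Phi$ are functions on the complement of $V(\mathfrak j)$. Two facts about this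
equation carry the theorem.

Overconvergence (`exists_mem_tball_of_frobMatrix_eq`): such an $f$ is bounded on some radius $r>1$.
The entries of $\Phi$ are, because $a\otimes1-1\otimes a^{q^i}$ is inverted by a geometric series
that still behaves well slightly beyond radius 1. The map $F=\Phi\tau$ contracts small vectors, as
$C c^q\le c/2$ for small $c$. Approximate $f$ by some $u$ with entries in $A\otimes L$. Its defect
$\eta=F(u)-u$ is small in the sup norm and bounded on a larger radius, hence by interpolation small
on an intermediate radius $r>1$. There $F^n(u)=u+\eta+F(\eta)+\dots+F^{n-1}(\eta)$ stays bounded by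
the ultrametric inequality, while $F^n(u)\to f$ in the sup norm.

Continuation (`algebraMap_mul_mem_boundedOn`): $\tau$ turns a function bounded on radius $r$ into
one bounded on radius $r^q$. Rereading $f=\Phi\tau(f)$ therefore extends $f$ from $r$ to $r^q$; the
poles of $f$ move by $\tau$, and those of $\Phi$ along $\mathfrak j$ are added. Since
$r^{q^m}\to\infty$, the function $f$ extends to all of $\mathfrak X_L$ with poles in $n\cdot J$, as
soon as $n$ bounds the pole orders of the entries of $\Phi$.

Restriction from $\mathfrak X_\rho$ to $\mathfrak X_1$ is injective (`Tate.restrict_one_injective`,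
`Mer.restrict_one_injective`), so extensions are unique, they glue over all $\rho$, and the
functional equation may be tested on $\mathfrak X_1$. All of this rests on the description of Gauss
norms by coordinates in a basis of $A$ adapted to the degree (`mem_rball_iff`). The comparison with
$M_B$ is flatness of $M$ together with the fact that $L\langle A\rangle\to\mathbb C_\infty\langle
A\rangle$ is isometric. -/

/-- An exhaustive increasing filtration of a vector space has an adapted basis: the coordinates of
an element of a step are supported in that step. -/
theorem Module.Basis.exists_adapted_to_filtration {F V : Type*} [Field F] [AddCommGroup V]
    [Module F V] (W : ℕ → Submodule F V) (hW : Monotone W) (htop : ∀ v, ∃ n, v ∈ W n) :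
    ∃ (s : Set V) (b : Module.Basis s F V), ∀ n, ∀ v ∈ W n, ∀ i, b.repr v i ≠ 0 → b i ∈ W n := by
  -- The hypotheses on `s` are placed under the existential so that the choice becomes a total
  -- function that can be iterated; for a bad `s` the value is the irrelevant `∅`.
  have step : ∀ (n : ℕ) (s : Set V), ∃ t : Set V, LinearIndepOn F id s → s ⊆ W n →
      (s ⊆ t ∧ t ⊆ W n ∧ (W n : Set V) ⊆ Submodule.span F t ∧ LinearIndepOn F id t) := by
    intro n s
    by_cases hs : LinearIndepOn F id s
    · by_cases hsn : s ⊆ W n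
      · obtain ⟨t, h1, h2, h3, h4⟩ := exists_linearIndepOn_id_extension hs hsn
        exact ⟨t, fun _ _ ↦ ⟨h2, h1, h3, h4⟩⟩
      · exact ⟨∅, fun _ h ↦ absurd h hsn⟩
    · exact ⟨∅, fun h ↦ absurd h hs⟩
  choose E hE using step
  let t : ℕ → Set V := fun n ↦ Nat.rec (E 0 ∅) (fun n s ↦ E (n + 1) s) n
  have h0 := hE 0 ∅ (linearIndepOn_empty F id) (Set.empty_subset _)
  have ht : ∀ n, t n ⊆ W n ∧ (W n : Set V) ⊆ Submodule.span F (t n) ∧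
      LinearIndepOn F id (t n) := by
    intro n
    induction n with
    | zero => exact h0.2
    | succ n ih =>
      exact (hE (n + 1) (t n) ih.2.2 (ih.1.trans (hW n.le_succ))).2
  have hmono : Monotone t := monotone_nat_of_le_succ fun n ↦
    (hE (n + 1) (t n) (ht n).2.2 ((ht n).1.trans (hW n.le_succ))).1
  have hli : LinearIndepOn F id (⋃ n, t n) :=
    linearIndepOn_iUnion_of_directed hmono.directed_le fun n ↦ (ht n).2.2
  have hspan : ⊤ ≤ Submodule.span F (Set.range (fun i : (⋃ n, t n) ↦ id (i : V))) := by
    intro v _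
    obtain ⟨n, hn⟩ := htop v
    refine Submodule.span_mono ?_ ((ht n).2.1 hn)
    intro x hx
    exact ⟨⟨x, Set.mem_iUnion.2 ⟨n, hx⟩⟩, rfl⟩
  let b := Module.Basis.mk hli hspan
  have hb : ∀ i, b i = i := fun i ↦ by simp [b]
  refine ⟨_, b, fun n v hv i hi ↦ ?_⟩
  -- Since `t n` already spans `W n` and is part of the basis, the support of `v` lies in `t n`,
  -- hence in `W n`.
  have hv' : v ∈ Submodule.span F (b '' {i | (i : V) ∈ t n}) := by
    refine Submodule.span_mono ?_ ((ht n).2.1 hv)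
    intro x hx
    exact ⟨⟨x, Set.mem_iUnion.2 ⟨n, hx⟩⟩, hx, hb _⟩
  rw [Module.Basis.mem_span_image] at hv'
  have : (i : V) ∈ t n := hv' (by simpa using hi)
  rw [hb]
  exact (ht n).1 this

namespace AMotive

/-! ### The degree filtration of $A$ and its adapted bases -/

section AdaptedBasis

variable {F K : Type*} [Field F] [Field K] [Algebra F K] {P : Place F K}
  [IsDiscreteValuationRing P.ring]

lemma deg_add_le {a b : K} {n : ℤ} (ha : a ≠ 0) (hb : b ≠ 0) (hab : a + b ≠ 0)
    (han : deg P a ≤ n) (hbn : deg P b ≤ n) : deg P (a + b) ≤ n := by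
  have h := (val P).map_add a b
  rcases le_max_iff.1 h with h | h
  · refine le_trans (mul_le_mul_of_nonneg_left ?_ (by positivity)) han
    exact (WithZero.log_le_log ((Valuation.ne_zero_iff _).2 hab)
      ((Valuation.ne_zero_iff _).2 ha)).2 h
  · refine le_trans (mul_le_mul_of_nonneg_left ?_ (by positivity)) hbn
    exact (WithZero.log_le_log ((Valuation.ne_zero_iff _).2 hab)
      ((Valuation.ne_zero_iff _).2 hb)).2 h

lemma deg_smul_le (c : F) {a : K} (ha : a ≠ 0) (hca : c • a ≠ 0) : deg P (c • a) ≤ deg P a := by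
  refine mul_le_mul_of_nonneg_left ?_ (by positivity)
  refine (WithZero.log_le_log ((Valuation.ne_zero_iff _).2 hca)
      ((Valuation.ne_zero_iff _).2 ha)).2 ?_
  rw [Algebra.smul_def, map_mul]
  exact mul_le_of_le_one_left' (val_le_one_iff.2 (P.algebraMap_mem c))

variable (P) in
/-- The elements of `A` of degree at most `n`. -/
def degLE (n : ℕ) : Submodule F (regularAway P) where
  carrier := {a | (a : K) ≠ 0 → deg P (a : K) ≤ n}
  zero_mem' h := absurd rfl h
  add_mem' {a b} ha hb h := by
    by_cases ha0 : (a : K) = 0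
    · simp only [AddMemClass.coe_add, ha0, zero_add] at h ⊢; exact hb h
    · by_cases hb0 : (b : K) = 0
      · simp only [AddMemClass.coe_add, hb0, add_zero] at h ⊢; exact ha h
      · exact deg_add_le ha0 hb0 h (ha ha0) (hb hb0)
  smul_mem' c a ha h := by
    have ha0 : (a : K) ≠ 0 := fun h0 ↦ h (by simp [h0])
    exact (deg_smul_le c ha0 h).trans (ha ha0)

/-- Each `a` is tested at the step of the filtration given by its own degree, which is a natural
number by `deg_nonneg`. Such a basis is what makes Gauss norms computable from coordinates. -/
lemma exists_adapted_basis [Fintype F] (P : Place F K) [IsDiscreteValuationRing P.ring] :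
    ∃ (s : Set (regularAway P)) (b : Module.Basis s F (regularAway P)),
      ∀ (a : regularAway P) (i : s), b.repr a i ≠ 0 →
        deg P (b i : K) ≤ deg P (a : K) := by
  obtain ⟨s, b, h⟩ := Module.Basis.exists_adapted_to_filtration (degLE P)
    (fun m n hmn a ha h ↦ (ha h).trans (by exact_mod_cast hmn))
    (fun a ↦ ⟨(deg P (a : K)).toNat, fun _ ↦ Int.self_le_toNat _⟩)
  refine ⟨s, b, fun a i hi ↦ ?_⟩
  have ha0 : (a : K) ≠ 0 := fun h0 ↦ hi (by
    have : a = 0 := Subtype.ext h0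
    rw [this]; simp)
  have hd := Int.toNat_of_nonneg (deg_nonneg a.2 ha0)
  have := h (deg P (a : K)).toNat a (fun _ ↦ hd.ge) i hi (by
    simpa using b.ne_zero i)
  exact this.trans hd.le

end AdaptedBasis

/-! ### Absolute values on fields containing a finite field -/

section FiniteConstants

variable {F : Type*} [Field F] [Fintype F] {L : Type*} [NormedField L] [Algebra F L]

/-- From $c^q=c$ one gets $|c|^q=|c|$. -/
lemma norm_algebraMap_le_one (c : F) : ‖algebraMap F L c‖ ≤ 1 := by
  have h : ‖algebraMap F L c‖ ^ Fintype.card F = ‖algebraMap F L c‖ := by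
    rw [← norm_pow, ← map_pow, FiniteField.pow_card]
  by_contra! h1
  exact (lt_self_pow₀ h1 Fintype.one_lt_card).ne' h

/-- The integers land in the finite field `F`, so their norms are bounded by one, and this forces
the ultrametric inequality. -/
lemma isUltrametricDist_of_finite (F : Type*) [Field F] [Fintype F] (L : Type*) [NormedField L]
    [Algebra F L] : IsUltrametricDist L := by
  refine IsUltrametricDist.isUltrametricDist_of_forall_norm_natCast_le_one fun n ↦ ?_
  simpa using norm_algebraMap_le_one (L := L) (n : F)

end FiniteConstants

/-! ### Gauss balls of arbitrary real radius in $A\otimes L$ -/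

section Balls

variable {F K : Type*} [Field F] [Fintype F] [Field K] [Algebra F K] (P : Place F K)
  [IsDiscreteValuationRing P.ring]
variable (L : Type*) [NormedField L] [Algebra F L]

/-- A basis of `A` adapted to the filtration by the degree. -/
def adaptedBasis : Module.Basis (exists_adapted_basis P).choose F (regularAway P) :=
  (exists_adapted_basis P).choose_spec.choose

variable {P L}

lemma deg_adaptedBasis_le {a : regularAway P} {i} (h : (adaptedBasis P).repr a i ≠ 0) :
    deg P (adaptedBasis P i : K) ≤ deg P (a : K) :=
  (exists_adapted_basis P).choose_spec.choose_spec a i h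

variable (P L) in
open scoped Classical in
/-- The coefficients of an element of `A ⊗ L` in the adapted basis. -/
def coef : AT P L ≃+ ((exists_adapted_basis P).choose →₀ L) :=
  (TensorProduct.equivFinsuppOfBasisLeft (N := L) (adaptedBasis P)).toAddEquiv

open scoped Classical in
lemma coef_mk (a : regularAway P) (l : L) (i) :
    coef P L (AT.mk a l) i = (adaptedBasis P).repr a i • l :=
  TensorProduct.equivFinsuppOfBasisLeft_apply_tmul_apply _ a l i

open scoped Classical in
lemma sum_coef (f : AT P L) :
    f = ∑ i ∈ (coef P L f).support, AT.mk (adaptedBasis P i) (coef P L f i) := by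
  refine ((coef P L).symm_apply_apply f).symm.trans ?_
  refine (TensorProduct.equivFinsuppOfBasisLeft_symm_apply (adaptedBasis P) _).trans ?_
  rfl

variable (P L) in
/-- The elements of `A ⊗ L` which are finite sums of tensors `a ⊗ ℓ` with `|ℓ| r ^ (deg a) ≤ C`,
for a real radius `r`. -/
def rball (r C : ℝ) : AddSubgroup (AT P L) :=
  AddSubgroup.closure {f | ∃ (a : regularAway P) (l : L), a ≠ 0 ∧
    ‖l‖ * r ^ deg P (a : K) ≤ C ∧ f = AT.mk a l}

/-- Real radii are needed because the radii produced below, slightly larger than one, need not lie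
in $|L^\times|$. -/
lemma gaussBall_eq_rball (ρ : Radius L) (C : ℝ) : gaussBall P ρ C = rball P L ρ.1 C := rfl

/-- The adapted basis is orthogonal for every radius $r\ge1$: the coordinates of $a\otimes\ell$
involve only basis elements of degree at most $\deg a$, with scalars of norm at most one, so passing
to coordinates never increases $|\ell|\,r^{\deg a}$. Sums are covered by the ultrametric inequality.
-/
lemma mem_rball_iff {r C : ℝ} (hr : 1 ≤ r) (hC : 0 ≤ C) {f : AT P L} :
    f ∈ rball P L r C ↔
      ∀ i, ‖coef P L f i‖ * r ^ deg P (adaptedBasis P i : K) ≤ C := by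
  have hr0 : 0 < r := by linarith
  constructor
  · intro hf i
    have hu := isUltrametricDist_of_finite F L
    induction hf using AddSubgroup.closure_induction with
    | mem f hf =>
      obtain ⟨a, l, ha, hl, rfl⟩ := hf
      rw [coef_mk]
      by_cases h : (adaptedBasis P).repr a i = 0
      · simpa [h] using hC
      · refine le_trans (mul_le_mul ?_ (zpow_le_zpow_right₀ hr (deg_adaptedBasis_le h))
          (by positivity) (norm_nonneg l)) hl
        rw [Algebra.smul_def, norm_mul]
        exact mul_le_of_le_one_left (norm_nonneg _) (norm_algebraMap_le_one _)
    | zero => simpa using hC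
    | add x y _ _ hx hy =>
      rw [map_add, Finsupp.add_apply]
      rcases le_max_iff.1 (IsUltrametricDist.norm_add_le_max (coef P L x i) (coef P L y i)) with h | h
      · exact (mul_le_mul_of_nonneg_right h (by positivity)).trans hx
      · exact (mul_le_mul_of_nonneg_right h (by positivity)).trans hy
    | neg x _ hx => rwa [map_neg, Finsupp.neg_apply, norm_neg]
  · intro h
    rw [sum_coef f]
    exact sum_mem fun i _ ↦ AddSubgroup.subset_closure
      ⟨_, _, (adaptedBasis P).ne_zero i, h i, rfl⟩

lemma rball_mono_right {r C C' : ℝ} (h : C ≤ C') : rball P L r C ≤ rball P L r C' := by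
  refine AddSubgroup.closure_mono ?_
  rintro f ⟨a, l, ha, h', rfl⟩
  exact ⟨a, l, ha, h'.trans h, rfl⟩

lemma rball_anti_left {r r' C : ℝ} (h1 : 1 ≤ r) (h : r ≤ r') :
    rball P L r' C ≤ rball P L r C := by
  refine AddSubgroup.closure_mono ?_
  rintro f ⟨a, l, ha, h', rfl⟩
  refine ⟨a, l, ha, le_trans ?_ h', rfl⟩
  have ha' : (a : K) ≠ 0 := by simpa using ha
  lift deg P (a : K) to ℕ using deg_nonneg a.2 ha' with d
  simp only [zpow_natCast]
  gcongr

/-- Interpolation between a bound of the sup norm and a bound at radius `r ^ N`. -/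
lemma mem_rball_of_interpolate {r δ C ε : ℝ} {N : ℕ} (hr : 1 ≤ r) (hδ : 0 ≤ δ) (hC : 0 ≤ C)
    (hε : 0 ≤ ε) (hN : δ ^ N * C ≤ ε ^ (N + 1)) {f : AT P L} (h1 : f ∈ rball P L 1 δ)
    (h2 : f ∈ rball P L (r ^ (N + 1)) C) : f ∈ rball P L r ε := by
  have hr0 : 0 < r := by linarith
  rw [mem_rball_iff le_rfl hδ] at h1
  rw [mem_rball_iff (one_le_pow₀ hr) hC] at h2
  rw [mem_rball_iff hr hε]
  intro i
  have e1 := h1 i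
  have e2 := h2 i
  rw [one_zpow, mul_one] at e1
  refine le_of_pow_le_pow_left₀ N.succ_ne_zero hε (le_trans ?_ hN)
  have : (r ^ (N + 1)) ^ deg P (adaptedBasis P i : K) =
      (r ^ deg P (adaptedBasis P i : K)) ^ (N + 1) := by
    rw [← zpow_natCast, ← zpow_natCast, ← zpow_mul, ← zpow_mul, mul_comm]
  rw [this] at e2
  calc (‖coef P L f i‖ * r ^ deg P (adaptedBasis P i : K)) ^ (N + 1)
      = ‖coef P L f i‖ ^ N *
        (‖coef P L f i‖ * (r ^ deg P (adaptedBasis P i : K)) ^ (N + 1)) := by ring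
    _ ≤ δ ^ N * C := by gcongr

lemma mul_mem_rball {r C D : ℝ} (hr : 1 ≤ r) (hC : 0 ≤ C) {f g : AT P L}
    (hf : f ∈ rball P L r C) (hg : g ∈ rball P L r D) : f * g ∈ rball P L r (C * D) := by
  have hρ : 0 < r := one_pos.trans_le hr
  induction hf using AddSubgroup.closure_induction with
  | mem f hf =>
    obtain ⟨a, l, ha, hl, rfl⟩ := hf
    induction hg using AddSubgroup.closure_induction with
    | mem g hg =>
      obtain ⟨b, m, hb, hm, rfl⟩ := hg
      refine AddSubgroup.subset_closure ⟨a * b, l * m, mul_ne_zero ha hb, ?_, AT.mk_mul ..⟩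
      have ha' : (a : K) ≠ 0 := by simpa using ha
      have hb' : (b : K) ≠ 0 := by simpa using hb
      rw [MulMemClass.coe_mul, deg_mul ha' hb', zpow_add₀ hρ.ne', norm_mul]
      calc _ = (‖l‖ * r ^ deg P (a : K)) * (‖m‖ * r ^ deg P (b : K)) := by ring
        _ ≤ C * D := mul_le_mul hl hm (by positivity) hC
    | zero => simp
    | add x y _ _ hx hy => rw [mul_add]; exact add_mem hx hy
    | neg x _ hx => rw [mul_neg]; exact neg_mem hx
  | zero => simp
  | add x y _ _ hx hy => rw [add_mul]; exact add_mem hx hy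
  | neg x _ hx => rw [neg_mul]; exact neg_mem hx

/-- Only the scalars are raised to the $q$-th power, and $|\ell^q|\,(r^q)^{\deg a}=(|\ell|\,r^{\deg
a})^q$. This gain of radius drives the analytic continuation. -/
lemma tau_mem_rball {r C : ℝ} (hr : 1 ≤ r) {f : AT P L} (hf : f ∈ rball P L r C) :
    tau P L f ∈ rball P L (r ^ Fintype.card F) (C ^ Fintype.card F) := by
  have hr0 : 0 < r := one_pos.trans_le hr
  induction hf using AddSubgroup.closure_induction with
  | mem f hf =>
    obtain ⟨a, l, ha, hl, rfl⟩ := hf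
    refine AddSubgroup.subset_closure ⟨a, l ^ Fintype.card F, ha, ?_, rfl⟩
    have : (r ^ Fintype.card F) ^ deg P (a : K) = (r ^ deg P (a : K)) ^ Fintype.card F := by
      rw [← zpow_natCast, ← zpow_natCast, ← zpow_mul, ← zpow_mul, mul_comm]
    rw [norm_pow, this, ← mul_pow]
    gcongr
  | zero => rw [map_zero]; exact zero_mem _
  | add x y _ _ hx hy => rw [map_add]; exact add_mem hx hy
  | neg x _ hx => rw [map_neg]; exact neg_mem hx

/-- Every element of `A ⊗ L` lies in some ball of any given radius. -/
lemma exists_mem_rball {r : ℝ} (hr : 1 ≤ r) (f : AT P L) : ∃ C, 0 ≤ C ∧ f ∈ rball P L r C := by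
  have hr0 : 0 < r := one_pos.trans_le hr
  induction f using AT.induction with
  | zero => exact ⟨0, le_rfl, zero_mem _⟩
  | mk a c =>
    by_cases ha : a = 0
    · subst ha; exact ⟨0, le_rfl, by rw [AT.zero_mk]; exact zero_mem _⟩
    · exact ⟨‖c‖ * r ^ deg P (a : K), by positivity,
        AddSubgroup.subset_closure ⟨a, c, ha, le_rfl, rfl⟩⟩
  | add x y hx hy =>
    obtain ⟨C, hC, hx⟩ := hx
    obtain ⟨D, hD, hy⟩ := hy
    exact ⟨max C D, hC.trans (le_max_left _ _), add_mem
      (rball_mono_right (le_max_left _ _) hx) (rball_mono_right (le_max_right _ _) hy)⟩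

/-- The infimum is attained, because membership amounts to closed inequalities between coordinates.
-/
lemma mem_gaussBall_iff_gaussNorm_le {ρ : Radius L} {f : AT P L} {C : ℝ} (hC : 0 ≤ C) :
    f ∈ gaussBall P ρ C ↔ gaussNorm P ρ f ≤ C := by
  refine ⟨gaussNorm_le hC, fun h ↦ ?_⟩
  rw [gaussBall_eq_rball, mem_rball_iff ρ.2.1 hC]
  refine fun i ↦ le_of_forall_pos_le_add fun ε hε ↦ ?_
  have := mem_gaussBall_of_lt (show gaussNorm P ρ f < C + ε by linarith)
  rw [gaussBall_eq_rball, mem_rball_iff ρ.2.1 (by positivity)] at this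
  exact this i

lemma gaussNorm_le_iff {ρ : Radius L} {f : AT P L} {C : ℝ} (hC : 0 ≤ C) :
    gaussNorm P ρ f ≤ C ↔ ∀ i, ‖coef P L f i‖ * ρ.1 ^ deg P (adaptedBasis P i : K) ≤ C := by
  rw [← mem_gaussBall_iff_gaussNorm_le hC, gaussBall_eq_rball, mem_rball_iff ρ.2.1 hC]

/-- The adapted basis belongs to $A$, so coordinates commute with extension of the scalar field. -/
lemma gaussNorm_map {L' : Type*} [NormedField L'] [Algebra F L'] (f : L →ₐ[F] L')
    (hf : ∀ x, ‖f x‖ = ‖x‖) (x : AT P L) :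
    gaussNorm P (1 : Radius L') (AT.map P f x) = gaussNorm P (1 : Radius L) x := by
  have hcoef : ∀ i, coef P L' (AT.map P f x) i = f (coef P L x i) := by
    intro i
    induction x using AT.induction with
    | zero => simp
    | mk a c => rw [AT.map_mk, coef_mk, coef_mk, map_smul]
    | add x y hx hy => simp only [map_add, Finsupp.add_apply, hx, hy]
  have key : ∀ C : ℝ, 0 ≤ C → (gaussNorm P (1 : Radius L') (AT.map P f x) ≤ C ↔
      gaussNorm P (1 : Radius L) x ≤ C) := by
    intro C hC
    rw [gaussNorm_le_iff hC, gaussNorm_le_iff hC]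
    simp only [hcoef, hf]
    rfl
  exact le_antisymm ((key _ (gaussNorm_nonneg _ _)).2 le_rfl)
    ((key _ (gaussNorm_nonneg _ _)).1 le_rfl)

end Balls

lemma exists_one_lt_pow_lt {c : ℝ} (hc : 1 < c) (d : ℕ) : ∃ r : ℝ, 1 < r ∧ r ^ d < c := by
  have h1 : ∀ᶠ r : ℝ in nhdsWithin 1 (Set.Ioi 1), r ^ d < c :=
    nhdsWithin_le_nhds (((continuous_pow d).tendsto (1 : ℝ)).eventually
      (gt_mem_nhds (by simpa using hc)))
  obtain ⟨r, h, h'⟩ := (h1.and eventually_mem_nhdsWithin).exists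
  exact ⟨r, h', h⟩

/-! ### The algebras $L\langle A\rangle_\rho$ and their restriction maps -/

section TateAlgebra

variable {F K : Type*} [Field F] [Fintype F] [Field K] [Algebra F K] {P : Place F K}
  [IsDiscreteValuationRing P.ring]
variable {L : Type*} [NormedField L] [Algebra F L] [Algebra K L] [IsScalarTower F K L]

lemma Tate.exists_norm_sub_of_lt {ρ : Radius L} (x : Tate P ρ) {ε : ℝ} (hε : 0 < ε) :
    ∃ f : AT P L, ‖x - Tate.of ρ f‖ < ε := by
  have hd : DenseRange ((↑) : GaussRing P ρ → UniformSpace.Completion (GaussRing P ρ)) :=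
    UniformSpace.Completion.denseRange_coe
  obtain ⟨f, hf⟩ := Metric.denseRange_iff.1 hd x ε hε
  refine ⟨(GaussRing.equiv ρ).symm f, ?_⟩
  have h := dist_eq_norm x (Tate.of ρ ((GaussRing.equiv ρ).symm f))
  rw [← h]
  exact hf

lemma Tate.continuous_map {L' : Type*} [NormedField L'] [Algebra F L'] {ρ : Radius L}
    {ρ' : Radius L'} (φ : AT P L →+* AT P L') (h : Continuous (GaussRing.hom ρ ρ' φ)) :
    Continuous (Tate.map φ h) :=
  UniformSpace.Completion.continuous_map

lemma Tate.continuous_restrict {ρ ρ' : Radius L} (h : ρ ≤ ρ') :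
    Continuous (Tate.restrict (P := P) h) := Tate.continuous_map _ (continuous_id_gauss h)

lemma Tate.restrict_of {ρ ρ' : Radius L} (h : ρ ≤ ρ') (f : AT P L) :
    Tate.restrict h (Tate.of ρ' f) = Tate.of ρ f := Tate.map_of _ (continuous_id_gauss h) f

lemma Tate.tau_of (ρ : Radius L) (f : AT P L) :
    Tate.tau ρ (Tate.of ρ f) = Tate.of ρ (AMotive.tau P L f) := Tate.map_of _ _ f

lemma Tate.continuous_tau (ρ : Radius L) : Continuous (Tate.tau (P := P) ρ) :=
  Tate.continuous_map _ _

/-- Two continuous maps out of `L⟨A⟩_ρ` agree if they agree on `A ⊗ L`. -/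
lemma Tate.funext_of_continuous {X : Type*} [TopologicalSpace X] [T2Space X] {ρ : Radius L}
    {f g : Tate P ρ → X} (hf : Continuous f) (hg : Continuous g)
    (h : ∀ x, f (Tate.of ρ x) = g (Tate.of ρ x)) (x : Tate P ρ) : f x = g x :=
  congrFun (UniformSpace.Completion.denseRange_coe (α := GaussRing P ρ) |>.equalizer hf hg
    (funext fun y ↦ h ((GaussRing.equiv ρ).symm y))) x

lemma Tate.restrict_restrict {ρ ρ' ρ'' : Radius L} (h : ρ ≤ ρ') (h' : ρ' ≤ ρ'') (h'' : ρ ≤ ρ'')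
    (x : Tate P ρ'') : Tate.restrict h (Tate.restrict h' x) = Tate.restrict h'' x :=
  Tate.funext_of_continuous ((continuous_restrict h).comp (continuous_restrict h'))
    (continuous_restrict h'') (fun f ↦ by simp [restrict_of]) x

lemma Tate.restrict_tau {ρ ρ' : Radius L} (h : ρ ≤ ρ') (x : Tate P ρ') :
    Tate.restrict h (Tate.tau ρ' x) = Tate.tau ρ (Tate.restrict h x) :=
  Tate.funext_of_continuous ((continuous_restrict h).comp (continuous_tau ρ'))
    ((continuous_tau ρ).comp (continuous_restrict h))
    (fun f ↦ by simp [restrict_of, tau_of]) x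

lemma Radius.one_le (ρ : Radius L) : (1 : Radius L) ≤ ρ := ρ.2.1

/-- Each single coordinate is already controlled by the sup norm. If `x` restricts to zero, then any
`g` in $A\otimes L$ sufficiently close to `x` at radius `ρ` has a tiny sup norm, hence a tiny `i`-th
coordinate. Comparing an arbitrary approximation `f` of `x` with such a `g`, one coordinate at a
time, shows that `f` itself is small at radius `ρ`. -/
lemma Tate.restrict_one_injective (ρ : Radius L) :
    Function.Injective (Tate.restrict (P := P) ρ.one_le) := by
  refine (injective_iff_map_eq_zero _).2 fun x hx ↦ norm_le_zero_iff.1 ?_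
  have hu := isUltrametricDist_of_finite F L
  have hρ := ρ.2.1
  have hρ0 : 0 < ρ.1 := by linarith
  refine le_of_forall_pos_le_add fun ε hε ↦ ?_
  obtain ⟨f, hf⟩ := x.exists_norm_sub_of_lt (show 0 < ε / 3 by linarith)
  suffices h : gaussNorm P ρ f ≤ 2 * (ε / 3) by
    calc ‖x‖ = ‖(x - Tate.of ρ f) + Tate.of ρ f‖ := by rw [sub_add_cancel]
      _ ≤ ‖x - Tate.of ρ f‖ + ‖Tate.of ρ f‖ := norm_add_le _ _
      _ ≤ ε / 3 + 2 * (ε / 3) := by rw [norm_tate_of]; gcongr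
      _ = 0 + ε := by ring
  refine (gaussNorm_le_iff (by positivity)).2 fun i ↦ ?_
  set d := deg P (adaptedBasis P i : K)
  -- The threshold depends on the index `i`, through $d$; this is harmless because `f` was fixed
  -- beforehand and only `g` varies with `i`.
  have hη : 0 < 2 * (ε / 3) / ρ.1 ^ d := by positivity
  have hc := (continuous_restrict (P := P) ρ.one_le).tendsto x
  rw [hx] at hc
  obtain ⟨δ, hδ, hball⟩ := Metric.eventually_nhds_iff.1
    (hc.eventually (Metric.ball_mem_nhds _ hη))
  obtain ⟨g, hg⟩ := x.exists_norm_sub_of_lt (show 0 < min δ (ε / 3) by positivity)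
  have hg1 := hball (show dist (Tate.of ρ g) x < δ by
    rw [dist_comm, dist_eq_norm]; exact hg.trans_le (min_le_left _ _))
  rw [dist_zero_right, restrict_of, norm_tate_of] at hg1
  have hfg : gaussNorm P ρ (f - g) ≤ 2 * (ε / 3) := by
    rw [← norm_tate_of, map_sub]
    calc ‖Tate.of ρ f - Tate.of ρ g‖ = ‖(x - Tate.of ρ g) - (x - Tate.of ρ f)‖ := by
          congr 1; abel
      _ ≤ ‖x - Tate.of ρ g‖ + ‖x - Tate.of ρ f‖ := norm_sub_le _ _
      _ ≤ 2 * (ε / 3) := by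
        have := hg.trans_le (min_le_right _ _); linarith
  have e1 := (gaussNorm_le_iff (by positivity)).1 hfg i
  have e2 := (gaussNorm_le_iff hη.le).1 hg1.le i
  rw [show (1 : Radius L).1 = 1 from rfl, one_zpow, mul_one, le_div_iff₀ (by positivity)] at e2
  have e3 : coef P L f i = coef P L (f - g) i + coef P L g i := by
    rw [map_sub, Finsupp.sub_apply, sub_add_cancel]
  rw [e3]
  rcases le_max_iff.1 (IsUltrametricDist.norm_add_le_max (coef P L (f - g) i) (coef P L g i)) with h | h
  · exact (mul_le_mul_of_nonneg_right h (by positivity)).trans e1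
  · exact (mul_le_mul_of_nonneg_right h (by positivity)).trans e2

lemma Tate.norm_map_of_isometry {L' : Type*} [NormedField L'] [Algebra F L'] {ρ : Radius L}
    {ρ' : Radius L'} (φ : AT P L →+* AT P L') (h : Continuous (GaussRing.hom ρ ρ' φ))
    (hφ : ∀ f, gaussNorm P ρ' (φ f) = gaussNorm P ρ f) (x : Tate P ρ) :
    ‖Tate.map φ h x‖ = ‖x‖ :=
  Tate.funext_of_continuous (continuous_norm.comp (continuous_map φ h)) continuous_norm
    (fun f ↦ by simp [Tate.map_of, norm_tate_of, hφ]) x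

lemma Tate.baseChange_injective {L' : Type*} [NormedField L'] [Algebra F L'] [Algebra K L']
    [IsScalarTower F K L'] (f : L →ₐ[K] L') (hf : ∀ x, ‖f x‖ = ‖x‖) :
    Function.Injective (Tate.baseChange (P := P) f hf) := by
  refine (injective_iff_map_eq_zero _).2 fun x hx ↦ norm_le_zero_iff.1 ?_
  have := Tate.norm_map_of_isometry (P := P) (ρ := 1) (ρ' := 1)
    (AT.map P (f.restrictScalars F) : AT P L →+* AT P L')
    (continuous_baseChange (f.restrictScalars F) hf) (gaussNorm_map _ hf) x
  rw [← this]
  exact (norm_eq_zero.2 hx).le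

lemma Tate.baseChange_tau {L' : Type*} [NormedField L'] [Algebra F L'] [Algebra K L']
    [IsScalarTower F K L'] (f : L →ₐ[K] L') (hf : ∀ x, ‖f x‖ = ‖x‖)
    (x : Tate P (1 : Radius L)) :
    Tate.baseChange f hf (Tate.tau 1 x) = Tate.tau 1 (Tate.baseChange f hf x) := by
  have hc : Continuous (Tate.baseChange (P := P) f hf) :=
    Tate.continuous_map _ (continuous_baseChange (f.restrictScalars F) hf)
  have hof : ∀ y, Tate.baseChange f hf (Tate.of 1 y) =
    Tate.of 1 (AT.map P (f.restrictScalars F) y) :=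
    fun y ↦ Tate.map_of _ (continuous_baseChange (f.restrictScalars F) hf) y
  exact Tate.funext_of_continuous (hc.comp (continuous_tau 1)) ((continuous_tau 1).comp hc)
    (fun y ↦ by simp only [Function.comp_apply, tau_of, hof, map_tau]) x

/-! ### Elements of $L\langle A\rangle$ bounded on a larger radius -/

variable (P L) in
/-- The elements of `L⟨A⟩` which are limits of finite sums of tensors `a ⊗ ℓ` with
`|ℓ| r ^ (deg a) ≤ C`: the functions bounded by `C` on the space of radius `r`. -/
def tball (r C : ℝ) : AddSubgroup (Tate P (1 : Radius L)) :=
  ((rball P L r C).map (Tate.of (1 : Radius L)).toAddMonoidHom).topologicalClosure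

lemma isClosed_tball (r C : ℝ) : IsClosed (tball P L r C : Set (Tate P (1 : Radius L))) :=
  AddSubgroup.isClosed_topologicalClosure _

lemma of_mem_tball {r C : ℝ} {f : AT P L} (hf : f ∈ rball P L r C) :
    Tate.of 1 f ∈ tball P L r C :=
  AddSubgroup.le_topologicalClosure _ ⟨f, hf, rfl⟩

lemma exists_norm_sub_lt_of_mem_tball {r C : ℝ} {x : Tate P (1 : Radius L)}
    (hx : x ∈ tball P L r C) {ε : ℝ} (hε : 0 < ε) :
    ∃ f ∈ rball P L r C, ‖x - Tate.of 1 f‖ < ε := by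
  obtain ⟨_, ⟨f, hf, rfl⟩, h⟩ := Metric.mem_closure_iff.1 hx ε hε
  exact ⟨f, hf, by rw [← dist_eq_norm]; exact h⟩

lemma mem_tball_of_forall {r C : ℝ} {x : Tate P (1 : Radius L)}
    (h : ∀ ε : ℝ, 0 < ε → ∃ f ∈ rball P L r C, ‖x - Tate.of 1 f‖ < ε) : x ∈ tball P L r C := by
  refine Metric.mem_closure_iff.2 fun ε hε ↦ ?_
  obtain ⟨f, hf, h⟩ := h ε hε
  exact ⟨_, ⟨f, hf, rfl⟩, by rw [dist_eq_norm]; exact h⟩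

lemma tball_mono_right {r C C' : ℝ} (h : C ≤ C') : tball P L r C ≤ tball P L r C' :=
  closure_mono (AddSubgroup.map_mono (rball_mono_right h))

lemma tball_anti_left {r r' C : ℝ} (h1 : 1 ≤ r) (h : r ≤ r') :
    tball P L r' C ≤ tball P L r C :=
  closure_mono (AddSubgroup.map_mono (rball_anti_left h1 h))

lemma norm_le_of_mem_tball {r C : ℝ} (hr : 1 ≤ r) (hC : 0 ≤ C) {x : Tate P (1 : Radius L)}
    (hx : x ∈ tball P L r C) : ‖x‖ ≤ C := by
  refine le_of_forall_pos_le_add fun ε hε ↦ ?_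
  obtain ⟨f, hf, h⟩ := exists_norm_sub_lt_of_mem_tball (tball_anti_left le_rfl hr hx) hε
  have hf' : ‖Tate.of (1 : Radius L) f‖ ≤ C := by
    rw [norm_tate_of]; exact gaussNorm_le hC hf
  calc ‖x‖ = ‖Tate.of 1 f + (x - Tate.of 1 f)‖ := by rw [add_sub_cancel]
    _ ≤ ‖Tate.of (1 : Radius L) f‖ + ‖x - Tate.of 1 f‖ := norm_add_le _ _
    _ ≤ C + ε := by gcongr

lemma mul_mem_tball {r C D : ℝ} (hr : 1 ≤ r) (hC : 0 ≤ C) {x y : Tate P (1 : Radius L)}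
    (hx : x ∈ tball P L r C) (hy : y ∈ tball P L r D) : x * y ∈ tball P L r (C * D) := by
  refine map_mem_closure₂ continuous_mul hx hy ?_
  rintro _ ⟨f, hf, rfl⟩ _ ⟨g, hg, rfl⟩
  exact ⟨f * g, mul_mem_rball hr hC hf hg, map_mul (Tate.of 1) f g⟩

lemma tau_mem_tball {r C : ℝ} (hr : 1 ≤ r) {x : Tate P (1 : Radius L)}
    (hx : x ∈ tball P L r C) :
    Tate.tau 1 x ∈ tball P L (r ^ Fintype.card F) (C ^ Fintype.card F) := by
  refine map_mem_closure (Tate.continuous_tau 1) hx ?_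
  rintro _ ⟨f, hf, rfl⟩
  exact ⟨_, tau_mem_rball hr hf, (Tate.tau_of 1 f).symm⟩

lemma exists_of_mem_tball {r : ℝ} (hr : 1 ≤ r) (f : AT P L) :
    ∃ C, 0 ≤ C ∧ Tate.of 1 f ∈ tball P L r C := by
  obtain ⟨C, hC, hf⟩ := exists_mem_rball hr f
  exact ⟨C, hC, of_mem_tball hf⟩

/-- Passage to the limit in `mem_rball_of_interpolate`: the strict inequality $\|x\|<\delta$ leaves
room for approximations that satisfy both bounds. -/
lemma mem_tball_of_interpolate {r δ C ε : ℝ} {N : ℕ} (hr : 1 ≤ r) (hC : 0 ≤ C)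
    (hε : 0 ≤ ε) (hN : δ ^ N * C ≤ ε ^ (N + 1)) {x : Tate P (1 : Radius L)} (h1 : ‖x‖ < δ)
    (h2 : x ∈ tball P L (r ^ (N + 1)) C) : x ∈ tball P L r ε := by
  refine mem_tball_of_forall fun η hη ↦ ?_
  obtain ⟨f, hf, h⟩ := exists_norm_sub_lt_of_mem_tball h2
    (show 0 < min η (δ - ‖x‖) from lt_min hη (by linarith))
  refine ⟨f, mem_rball_of_interpolate hr ((norm_nonneg x).trans h1.le) hC hε hN ?_ hf,
    h.trans_le (min_le_left _ _)⟩
  refine mem_gaussBall_of_lt (ρ := (1 : Radius L)) ?_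
  rw [← norm_tate_of]
  have := h.trans_le (min_le_right _ _)
  calc ‖Tate.of (1 : Radius L) f‖ = ‖x - (x - Tate.of 1 f)‖ := by rw [sub_sub_cancel]
    _ ≤ ‖x‖ + ‖x - Tate.of 1 f‖ := norm_sub_le _ _
    _ < δ := by linarith

/-- Functions bounded on the space of radius `ρ ^ 2` converge on `𝔛_ρ`. -/
lemma exists_restrict_eq_of_mem_tball (ρ : Radius L) {r C : ℝ} (hr : ρ.1 ^ 2 ≤ r) (hC : 0 ≤ C)
    {x : Tate P (1 : Radius L)} (hx : x ∈ tball P L r C) :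
    ∃ y, Tate.restrict ρ.one_le y = x := by
  have hx := tball_anti_left (one_le_pow₀ ρ.2.1) hr hx
  have hpos : ∀ n : ℕ, (0 : ℝ) < 1 / (n + 1) := fun n ↦ Nat.one_div_pos_of_nat
  choose f hf hfx using fun n : ℕ ↦ exists_norm_sub_lt_of_mem_tball hx (hpos n)
  have hlim : Filter.Tendsto (fun n ↦ Tate.of (1 : Radius L) (f n)) Filter.atTop (nhds x) := by
    rw [tendsto_iff_norm_sub_tendsto_zero]
    refine squeeze_zero (fun _ ↦ norm_nonneg _) (fun n ↦ ?_) tendsto_one_div_add_atTop_nhds_zero_nat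
    rw [norm_sub_rev]
    exact (hfx n).le
  have hcau : CauchySeq fun n ↦ Tate.of ρ (f n) := by
    refine Metric.cauchySeq_iff.2 fun ε hε ↦ ?_
    -- Interpolation with $N=1$ between radius 1 and radius $\rho^2$ requires $\delta
    -- C\le(\varepsilon/2)^2$; the denominator $C+1$ avoids division by zero.
    have hη : 0 < (ε / 2) ^ 2 / (C + 1) := by positivity
    obtain ⟨N, hN⟩ := Metric.cauchySeq_iff.1 hlim.cauchySeq _ hη
    refine ⟨N, fun m hm n hn ↦ ?_⟩
    have h : ‖Tate.of (1 : Radius L) (f m - f n)‖ < (ε / 2) ^ 2 / (C + 1) := by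
      rw [map_sub, ← dist_eq_norm]
      exact hN m hm n hn
    rw [norm_tate_of] at h
    rw [dist_eq_norm, ← map_sub, norm_tate_of]
    have h' : f m - f n ∈ rball P L 1 ((ε / 2) ^ 2 / (C + 1)) :=
      mem_gaussBall_of_lt (ρ := (1 : Radius L)) h
    have := mem_rball_of_interpolate (N := 1) (ε := ε / 2) (C := C) ρ.2.1 hη.le hC
      (by positivity) (by
        rw [pow_one, div_mul_eq_mul_div, div_le_iff₀ (by positivity)]
        gcongr
        linarith) h' (sub_mem (hf m) (hf n))
    exact (gaussNorm_le (by positivity) this).trans_lt (by linarith)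
  obtain ⟨y, hy⟩ := cauchySeq_tendsto_of_complete hcau
  have hlim' : Filter.Tendsto (fun n ↦ Tate.of (1 : Radius L) (f n)) Filter.atTop
      (nhds (Tate.restrict ρ.one_le y)) :=
    (((Tate.continuous_restrict (P := P) ρ.one_le).tendsto y).comp hy).congr
      fun n ↦ Tate.restrict_of ρ.one_le (f n)
  exact ⟨y, tendsto_nhds_unique hlim' hlim⟩

variable [IsNormedOver P L]

/-- The elements of `poleSet` have inverses which converge on a space of radius greater than one. -/
lemma exists_inverse_mem_tball {s : AT P K} (hs : s ∈ poleSet P) :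
    ∃ r : ℝ, 1 < r ∧ ∃ C : ℝ, 0 ≤ C ∧ ∃ y ∈ tball P L r C,
      algebraMap (AT P K) (Tate P (1 : Radius L)) s * y = 1 := by
  induction hs using Submonoid.closure_induction with
  | one =>
    obtain ⟨C, hC, h⟩ := exists_of_mem_tball (P := P) (L := L) one_le_two 1
    exact ⟨2, one_lt_two, C, hC, _, h, by simp⟩
  | mul s t _ _ hs ht =>
    obtain ⟨r, hr, C, hC, y, hy, hsy⟩ := hs
    obtain ⟨r', hr', C', hC', y', hy', hty⟩ := ht
    have h1 : 1 < min r r' := lt_min hr hr'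
    refine ⟨min r r', h1, C * C', by positivity, y * y', mul_mem_tball h1.le hC
      (tball_anti_left h1.le (min_le_left _ _) hy)
      (tball_anti_left h1.le (min_le_right _ _) hy'), ?_⟩
    rw [map_mul, mul_mul_mul_comm, hsy, hty, one_mul]
  | mem s hs =>
    obtain ⟨a, ha, i, rfl⟩ := hs
    set c : L := (algebraMap K L a) ^ Fintype.card F ^ i with hc
    have hc1 : 1 < ‖c‖ := by
      rw [hc, norm_pow]
      exact one_lt_pow₀ (IsNormedOver.one_lt_norm (P := P) _ ha)
        (pow_ne_zero _ Fintype.card_ne_zero)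
    have hc0 : c ≠ 0 := by rintro h; rw [h, norm_zero] at hc1; linarith
    have ha0 : a ≠ 0 := by rintro rfl; exact ha (zero_mem _)
    have ha0' : (a : K) ≠ 0 := by simpa using ha0
    -- The generator is $-(1\otimes c)(1-a\otimes c^{-1})$, to be inverted by a geometric series in
    -- $z=a\otimes c^{-1}$.
    have key : algebraMap (AT P K) (Tate P (1 : Radius L))
        (AT.mk a 1 - AT.mk 1 ((a : K) ^ Fintype.card F ^ i)) =
        - (Tate.of 1 (AT.mk 1 c) * (1 - Tate.of 1 (AT.mk a c⁻¹))) := by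
      rw [algebraMap_tate, mul_sub, mul_one, ← map_mul, AT.mk_mul, one_mul,
        mul_inv_cancel₀ hc0, ← map_sub, ← map_neg, map_sub]
      simp [hc]
    set z : Tate P (1 : Radius L) := Tate.of 1 (AT.mk a c⁻¹) with hz
    -- With $r^{\deg a}<|c|$, the element $z$ and hence all its powers are bounded by 1 on radius
    -- $r$.
    obtain ⟨r, hr, hrc⟩ := exists_one_lt_pow_lt hc1 (deg P (a : K)).toNat
    have hr0 : 0 < r := by linarith
    have hzr : z ∈ tball P L r 1 := by
      refine of_mem_tball (AddSubgroup.subset_closure ⟨a, c⁻¹, ha0, ?_, rfl⟩)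
      rw [← Int.toNat_of_nonneg (deg_nonneg a.2 ha0'), zpow_natCast, norm_inv,
        inv_mul_le_iff₀ (by linarith), mul_one]
      exact hrc.le
    have hone : (1 : Tate P (1 : Radius L)) ∈ tball P L r 1 := by
      rw [← map_one (Tate.of 1), AT.one_def]
      refine of_mem_tball (AddSubgroup.subset_closure ⟨1, 1, one_ne_zero, ?_, rfl⟩)
      rw [OneMemClass.coe_one, deg_one]; simp
    have hzn : ∀ n : ℕ, z ^ n ∈ tball P L r 1 := by
      intro n
      induction n with
      | zero => rwa [pow_zero]
      | succ n ih => rw [pow_succ]; simpa using mul_mem_tball hr.le zero_le_one ih hzr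
    have hz1 : ‖z‖ < 1 := by
      rw [norm_tate_of]
      refine (gaussNorm_le (norm_nonneg c⁻¹) ?_).trans_lt ?_
      · refine AddSubgroup.subset_closure ⟨a, c⁻¹, ha0, ?_, rfl⟩
        rw [show (1 : Radius L).1 = 1 from rfl, one_zpow, mul_one]
      · rw [norm_inv]; exact inv_lt_one_of_one_lt₀ hc1
    -- Convergence is only needed in the sup norm, where $\|z\|<1$; on radius $r$ it suffices that
    -- the partial sums stay in a closed additive subgroup.
    have hsum : ∑' n : ℕ, z ^ n ∈ tball P L r 1 := by
      refine (isClosed_tball r 1).mem_of_tendsto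
        (summable_geometric_of_norm_lt_one hz1).hasSum.tendsto_sum_nat
        (Filter.Eventually.of_forall fun n ↦ sum_mem fun i _ ↦ hzn i)
    obtain ⟨C, hC, hci⟩ := exists_of_mem_tball (P := P) (L := L) hr.le (AT.mk 1 c⁻¹)
    refine ⟨r, hr, C * 1, by positivity, - (Tate.of 1 (AT.mk 1 c⁻¹) * ∑' n : ℕ, z ^ n),
      neg_mem (mul_mem_tball hr.le hC hci hsum), ?_⟩
    have h1 : Tate.of (1 : Radius L) (AT.mk (P := P) (F := F) 1 c) * Tate.of 1 (AT.mk 1 c⁻¹)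
        = 1 := by
      rw [← map_mul, AT.mk_mul, mul_inv_cancel₀ hc0, one_mul, ← AT.one_def, map_one]
    have h2 : (1 - z) * ∑' n : ℕ, z ^ n = 1 := mul_neg_geom_series z hz1
    rw [key]
    linear_combination (1 - z) * (∑' n : ℕ, z ^ n) * h1 + h2

/-- Write the function as a fraction $x/s$ with $s$ in `poleSet`: the numerator is bounded on every
radius, and $1/s$ on some radius greater than one. -/
lemma exists_kappa_mem_tball (φ : jComplement P) :
    ∃ r : ℝ, 1 < r ∧ ∃ C : ℝ, 0 ≤ C ∧ kappa P (Tate P (1 : Radius L)) φ ∈ tball P L r C := by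
  obtain ⟨⟨x, s⟩, hxs⟩ := IsLocalization.surj (poleSet P) (φ : PoleLoc P)
  obtain ⟨r, hr, C, hC, y, hy, hsy⟩ := exists_inverse_mem_tball (L := L) s.2
  obtain ⟨D, hD, hx⟩ := exists_of_mem_tball hr.le
    (AT.map P (IsScalarTower.toAlgHom F K L) x)
  refine ⟨r, hr, D * C, by positivity, ?_⟩
  rw [← algebraMap_tate] at hx
  convert mul_mem_tball hr.le hD hx hy using 1
  have hφ : kappa P (Tate P (1 : Radius L)) φ * algebraMap (AT P K) _ (s : AT P K) =
      algebraMap (AT P K) _ x := by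
    have : φ * algebraMap (AT P K) (jComplement P) s = algebraMap _ _ x := Subtype.ext hxs
    rw [← AlgHom.commutes (kappa P (Tate P (1 : Radius L))), ← map_mul, this, AlgHom.commutes]
  rw [← hφ, mul_assoc, hsy, mul_one]

end TateAlgebra

/-! ### Overconvergence of solutions of $f=\Phi\cdot\tau(f)$ -/

section Overconvergence

variable {F K : Type*} [Field F] [Fintype F] [Field K] [Algebra F K] {P : Place F K}
  [IsDiscreteValuationRing P.ring]
variable {L : Type*} [NormedField L] [Algebra F L] [Algebra K L] [IsScalarTower F K L]

lemma mem_tball_one_of_norm_lt {δ : ℝ} {x : Tate P (1 : Radius L)} (hx : ‖x‖ < δ) :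
    x ∈ tball P L 1 δ := by
  refine mem_tball_of_forall fun η hη ↦ ?_
  obtain ⟨f, h⟩ := x.exists_norm_sub_of_lt
    (show 0 < min η (δ - ‖x‖) from lt_min hη (by linarith))
  refine ⟨f, mem_gaussBall_of_lt (ρ := (1 : Radius L)) ?_, h.trans_le (min_le_left _ _)⟩
  rw [← norm_tate_of]
  have := h.trans_le (min_le_right _ _)
  calc ‖Tate.of (1 : Radius L) f‖ = ‖x - (x - Tate.of 1 f)‖ := by rw [sub_sub_cancel]
    _ ≤ ‖x‖ + ‖x - Tate.of 1 f‖ := norm_sub_le _ _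
    _ < δ := by linarith

lemma exists_forall_mem_tball {ι : Type*} [Finite ι] (x : ι → Tate P (1 : Radius L))
    (h : ∀ i, ∃ r : ℝ, 1 < r ∧ ∃ C : ℝ, 0 ≤ C ∧ x i ∈ tball P L r C) :
    ∃ r : ℝ, 1 < r ∧ ∃ C : ℝ, 0 ≤ C ∧ ∀ i, x i ∈ tball P L r C := by
  classical
  have := Fintype.ofFinite ι
  suffices H : ∀ s : Finset ι, ∃ r : ℝ, 1 < r ∧ ∃ C : ℝ, 0 ≤ C ∧ ∀ i ∈ s, x i ∈ tball P L r C by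
    simpa using H Finset.univ
  intro s
  induction s using Finset.induction_on with
  | empty => exact ⟨2, one_lt_two, 0, le_rfl, by simp⟩
  | insert i s _ ih =>
    obtain ⟨r, hr, C, hC, hs⟩ := ih
    obtain ⟨r', hr', C', -, hi⟩ := h i
    have h1 : 1 < min r r' := lt_min hr hr'
    refine ⟨min r r', h1, max C C', hC.trans (le_max_left _ _), fun j hj ↦ ?_⟩
    rcases Finset.mem_insert.1 hj with rfl | hj
    · exact tball_mono_right (le_max_right _ _) (tball_anti_left h1.le (min_le_right _ _) hi)
    · exact tball_mono_right (le_max_left _ _)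
        (tball_anti_left h1.le (min_le_left _ _) (hs j hj))

variable {ι : Type*} [Fintype ι]

/-- The semilinear endomorphism `u ↦ Φ · τ(u)` of the vectors over `L⟨A⟩`. -/
def frobMatrix (Φ : ι → ι → Tate P (1 : Radius L)) :
    (ι → Tate P (1 : Radius L)) →+ (ι → Tate P (1 : Radius L)) where
  toFun u i := ∑ j, Φ i j * Tate.tau 1 (u j)
  map_zero' := by ext; simp
  map_add' u v := by ext; simp [mul_add, Finset.sum_add_distrib]

lemma frobMatrix_apply (Φ : ι → ι → Tate P (1 : Radius L)) (u : ι → Tate P (1 : Radius L)) (i : ι) :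
    frobMatrix Φ u i = ∑ j, Φ i j * Tate.tau 1 (u j) := rfl

/-- The factor $\tau(u_j)$ is bounded even on radius $r^q\ge r$, and here only radius $r$ is
retained. The exponent $q$ on $c$ makes the map contracting on small vectors. -/
lemma frobMatrix_mem_tball {Φ : ι → ι → Tate P (1 : Radius L)} {r₀ r C c : ℝ}
    (hΦ : ∀ i j, Φ i j ∈ tball P L r₀ C) (hC : 0 ≤ C) (hr : 1 ≤ r) (hr₀ : r ≤ r₀)
    {u : ι → Tate P (1 : Radius L)} (hu : ∀ i, u i ∈ tball P L r c) (i : ι) :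
    frobMatrix Φ u i ∈ tball P L r (C * c ^ Fintype.card F) :=
  sum_mem fun j _ ↦ mul_mem_tball hr hC (tball_anti_left hr hr₀ (hΦ i j))
    (tball_anti_left hr (le_self_pow₀ hr Fintype.card_ne_zero) (tau_mem_tball hr (hu j)))

/-- A solution over `L⟨A⟩` of an equation `f = Φ · τ(f)` with overconvergent coefficients is
overconvergent. -/
theorem exists_mem_tball_of_frobMatrix_eq {Φ : ι → ι → Tate P (1 : Radius L)} {r₀ C₀ : ℝ}
    (hr₀ : 1 < r₀) (hC₀ : 0 ≤ C₀) (hΦ : ∀ i j, Φ i j ∈ tball P L r₀ C₀)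
    {f : ι → Tate P (1 : Radius L)} (hf : frobMatrix Φ f = f) :
    ∃ r : ℝ, 1 < r ∧ ∃ C : ℝ, 0 ≤ C ∧ ∀ i, f i ∈ tball P L r C := by
  set C := C₀ + 1 with hCdef
  have hC : 0 < C := by positivity
  replace hΦ : ∀ i j, Φ i j ∈ tball P L r₀ C := fun i j ↦ tball_mono_right (by linarith) (hΦ i j)
  -- With this radius of contraction, $c\le\varepsilon\le1$ and $q\ge2$ give $C c^q\le C\varepsilon
  -- c=c/2$.
  set ε := 1 / (2 * C) with hεdef
  have hε : 0 < ε := by positivity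
  have hCε : C * ε = 1 / 2 := by rw [hεdef]; field_simp
  have hε1 : ε ≤ 1 := by nlinarith
  have hcontr : ∀ c : ℝ, 0 ≤ c → c ≤ ε → C * c ^ Fintype.card F ≤ c / 2 := by
    intro c hc hcε
    have h2 : c ^ Fintype.card F ≤ c ^ 2 :=
      pow_le_pow_of_le_one hc (hcε.trans hε1) Fintype.one_lt_card
    calc C * c ^ Fintype.card F ≤ C * (c * ε) := by
          gcongr; rw [pow_two] at h2; exact h2.trans (by gcongr)
      _ = c / 2 := by linear_combination c * hCε
  choose p hp using fun i ↦ (f i).exists_norm_sub_of_lt (show 0 < ε / 4 by positivity)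
  set u : ι → Tate P (1 : Radius L) := fun i ↦ Tate.of 1 (p i) with hu
  have he : ∀ i, (f - u) i ∈ tball P L 1 (ε / 4) := fun i ↦ mem_tball_one_of_norm_lt (hp i)
  -- The error $f-u$ is contracted to zero in the sup norm; as $f$ is fixed, the iterates of $u$
  -- converge to $f$.
  have hiter : ∀ n i, ((frobMatrix Φ)^[n] (f - u)) i ∈ tball P L 1 (ε / 4 / 2 ^ n) := by
    intro n
    induction n with
    | zero => simpa using he
    | succ n ih =>
      intro i
      rw [Function.iterate_succ_apply']
      refine tball_mono_right ?_ (frobMatrix_mem_tball hΦ hC.le le_rfl hr₀.le ih i)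
      have h2 : ε / 4 / 2 ^ n ≤ ε := by
        rw [div_div, div_le_iff₀ (by positivity)]
        have : (1 : ℝ) ≤ 2 ^ n := one_le_pow₀ one_le_two
        nlinarith
      refine (hcontr _ (by positivity) h2).trans_eq ?_
      rw [div_div, ← pow_succ]
  set η := frobMatrix Φ u - u with hη
  have hη1 : ∀ i, ‖η i‖ < ε / 2 := by
    intro i
    -- Because $f$ is fixed, the defect of $u$ is expressed through the error $f-u$ and is therefore
    -- small.
    have h1 : η = (f - u) - frobMatrix Φ (f - u) := by rw [map_sub, hf, hη]; abel
    have h2 : η i ∈ tball P L 1 (ε / 4) := by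
      rw [h1]
      refine sub_mem (he i) (tball_mono_right ?_ (hiter 1 i))
      rw [pow_one]; linarith
    exact (norm_le_of_mem_tball le_rfl (by positivity) h2).trans_lt (by linarith)
  choose D hD hpD using fun i ↦ exists_of_mem_tball (L := L) hr₀.le (p i)
  have huD : ∀ i, u i ∈ tball P L r₀ (∑ i, D i) := fun i ↦
    tball_mono_right (Finset.single_le_sum (fun j _ ↦ hD j) (Finset.mem_univ i)) (hpD i)
  set D' := ∑ i, D i
  have hD' : 0 ≤ D' := Finset.sum_nonneg fun i _ ↦ hD i
  set C₁ := max (C * D' ^ Fintype.card F) D' with hC₁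
  have hC₁0 : 0 ≤ C₁ := hD'.trans (le_max_right _ _)
  have hη2 : ∀ i, η i ∈ tball P L r₀ C₁ := fun i ↦
    sub_mem (tball_mono_right (le_max_left _ _)
      (frobMatrix_mem_tball hΦ hC.le hr₀.le le_rfl huD i))
      (tball_mono_right (le_max_right _ _) (huD i))
  -- The condition $C_1<2^N\varepsilon$ is what interpolation with $\delta=\varepsilon/2$ needs,
  -- namely $(\varepsilon/2)^N C_1\le\varepsilon^{N+1}$; then $r$ is taken so close to one that
  -- $r^{N+1}<r_0$.
  obtain ⟨N, hN⟩ := pow_unbounded_of_one_lt (C₁ / ε) (one_lt_two (α := ℝ))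
  obtain ⟨r, hr, hrr₀⟩ := exists_one_lt_pow_lt hr₀ (N + 1)
  have hr' : r ≤ r₀ := (le_self_pow₀ hr.le N.succ_ne_zero).trans hrr₀.le
  have hη3 : ∀ i, η i ∈ tball P L r ε := fun i ↦ by
    refine mem_tball_of_interpolate (N := N) hr.le hC₁0 hε.le ?_ (hη1 i)
      (tball_anti_left (one_le_pow₀ hr.le) hrr₀.le (hη2 i))
    rw [div_lt_iff₀ hε] at hN
    calc (ε / 2) ^ N * C₁ ≤ (ε / 2) ^ N * (2 ^ N * ε) := by gcongr
      _ = ε ^ (N + 1) := by rw [div_pow, pow_succ]; field_simp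
  have hη4 : ∀ n i, ((frobMatrix Φ)^[n] η) i ∈ tball P L r ε := by
    intro n
    induction n with
    | zero => exact hη3
    | succ n ih =>
      intro i
      rw [Function.iterate_succ_apply']
      exact tball_mono_right ((hcontr ε hε.le le_rfl).trans (by linarith))
        (frobMatrix_mem_tball hΦ hC.le hr.le hr' ih i)
  have hun : ∀ n i, ((frobMatrix Φ)^[n] u) i ∈ tball P L r (max D' ε) := by
    intro n
    induction n with
    | zero => exact fun i ↦ tball_mono_right (le_max_left _ _) (tball_anti_left hr.le hr' (huD i))
    | succ n ih =>
      intro i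
      -- Telescoping: each iteration adds an iterate of the defect, all bounded by `ε` on radius
      -- `r`. The balls are additive groups, so the bound does not grow with `n`.
      have : (frobMatrix Φ)^[n + 1] u = (frobMatrix Φ)^[n] u + (frobMatrix Φ)^[n] η := by
        rw [Function.iterate_succ_apply, ← iterate_map_add, hη, add_sub_cancel]
      rw [this]
      exact add_mem (ih i) (tball_mono_right (le_max_right _ _) (hη4 n i))
  refine ⟨r, hr, max D' ε, hD'.trans (le_max_left _ _), fun i ↦ ?_⟩
  -- The ball of radius `r` is closed in the sup norm, so convergence on radius `r` need not be
  -- checked.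
  refine (isClosed_tball r _).mem_of_tendsto (f := fun n : ℕ ↦ ((frobMatrix Φ)^[n] u) i)
    (b := Filter.atTop) ?_ (Filter.Eventually.of_forall fun n ↦ hun n i)
  rw [tendsto_iff_norm_sub_tendsto_zero]
  have hlim : Filter.Tendsto (fun n : ℕ ↦ ε / 4 / (2 : ℝ) ^ n) Filter.atTop (nhds 0) :=
    tendsto_const_nhds.div_atTop (tendsto_pow_atTop_atTop_of_one_lt one_lt_two)
  refine squeeze_zero (fun _ ↦ norm_nonneg _) (fun n ↦ ?_) hlim
  have h1 : f = (frobMatrix Φ)^[n] f := (Function.iterate_fixed hf n).symm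
  have h2 := norm_le_of_mem_tball le_rfl (by positivity) (hiter n i)
  rwa [iterate_map_sub, ← h1, Pi.sub_apply, norm_sub_rev] at h2

/-! ### Analytic continuation by $\tau$ and control of the poles -/

variable (P L) in
/-- The functions which are bounded on the space of radius `r`. -/
def boundedOn (r : ℝ) (hr : 1 ≤ r) : Subring (Tate P (1 : Radius L)) where
  carrier := {x | ∃ C : ℝ, 0 ≤ C ∧ x ∈ tball P L r C}
  mul_mem' := by
    rintro x y ⟨C, hC, hx⟩ ⟨D, hD, hy⟩
    exact ⟨C * D, by positivity, mul_mem_tball hr hC hx hy⟩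
  one_mem' := by
    obtain ⟨C, hC, h⟩ := exists_of_mem_tball (P := P) (L := L) hr 1
    exact ⟨C, hC, by simpa using h⟩
  add_mem' := by
    rintro x y ⟨C, hC, hx⟩ ⟨D, hD, hy⟩
    exact ⟨max C D, hC.trans (le_max_left _ _),
      add_mem (tball_mono_right (le_max_left _ _) hx) (tball_mono_right (le_max_right _ _) hy)⟩
  zero_mem' := ⟨0, le_rfl, zero_mem _⟩
  neg_mem' := by
    rintro x ⟨C, hC, hx⟩
    exact ⟨C, hC, neg_mem hx⟩

lemma algebraMap_mem_boundedOn {r : ℝ} (hr : 1 ≤ r) (b : AT P K) :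
    algebraMap (AT P K) (Tate P (1 : Radius L)) b ∈ boundedOn P L r hr :=
  exists_of_mem_tball hr _

lemma tau_mem_boundedOn {r r' : ℝ} (hr : 1 ≤ r) (hr' : 1 ≤ r') (h : r ^ Fintype.card F = r')
    {x : Tate P (1 : Radius L)} (hx : x ∈ boundedOn P L r hr) :
    Tate.tau 1 x ∈ boundedOn P L r' hr' := by
  obtain ⟨C, hC, hx⟩ := hx
  subst h
  exact ⟨_, by positivity, tau_mem_tball hr hx⟩

lemma map_tau_jTwist (i : ℕ) :
    (jTwist P i).map (tau P K : AT P K →+* AT P K) = jTwist P (i + 1) := by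
  rw [jTwist, jTwist, Ideal.map_map, pow_succ']; rfl

/-- An index shift, in the form in which poles of $\Phi\cdot\tau(f)$ arise: those of $f$ moved by
$\tau$, together with $\mathfrak j$ coming from $\Phi$. -/
lemma prod_jTwist_succ (m : ℕ) : ∏ i ∈ Finset.range (m + 1), jTwist P i =
    (∏ i ∈ Finset.range m, jTwist P i).map (tau P K : AT P K →+* AT P K) * jIdeal P := by
  have h0 : jTwist P 0 = jIdeal P := Ideal.map_id _
  rw [Finset.prod_range_succ', h0]
  congr 1
  have := map_prod (Ideal.mapHom (tau P K : AT P K →+* AT P K)) (fun i ↦ jTwist P i)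
    (Finset.range m)
  simp only [Ideal.mapHom_apply] at this
  rw [this]
  exact Finset.prod_congr rfl fun i _ ↦ (map_tau_jTwist i).symm

/-- If the poles of `Φ` are contained in `n · 𝔧` and `f = Φ · τ(f)` is bounded on the space of
radius `r`, then `f` is meromorphic on the space of radius `r ^ (q ^ m)`, with poles contained in
`n · J_(m-1)`. -/
theorem algebraMap_mul_mem_boundedOn {Φ : ι → ι → Tate P (1 : Radius L)} {n : ℕ}
    (hΦ : ∀ g ∈ jIdeal P ^ n, ∀ i j, algebraMap (AT P K) _ g * Φ i j ∈
      (algebraMap (AT P K) (Tate P (1 : Radius L))).range)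
    {f : ι → Tate P (1 : Radius L)} (hf : frobMatrix Φ f = f)
    {r : ℝ} (hr : 1 ≤ r) (hfr : ∀ i, f i ∈ boundedOn P L r hr) (m : ℕ) :
    ∀ g ∈ (∏ i ∈ Finset.range m, jTwist P i) ^ n, ∀ i, algebraMap (AT P K) _ g * f i ∈
      boundedOn P L (r ^ Fintype.card F ^ m) (one_le_pow₀ hr) := by
  induction m with
  | zero =>
    intro g _ i
    simp only [pow_zero, pow_one]
    exact mul_mem (algebraMap_mem_boundedOn hr g) (hfr i)
  | succ m ih =>
    have hr' : 1 ≤ r ^ Fintype.card F ^ (m + 1) := one_le_pow₀ hr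
    -- On generators of the extended ideal, $\tau(g)\tau(f_i)=\tau(g f_i)$, so the induction
    -- hypothesis applies and the radius is raised to the power $q$.
    have hτ : ∀ g ∈ ((∏ i ∈ Finset.range m, jTwist P i) ^ n).map
        (tau P K : AT P K →+* AT P K), ∀ i, algebraMap (AT P K) _ g * Tate.tau 1 (f i) ∈
        boundedOn P L (r ^ Fintype.card F ^ (m + 1)) hr' := by
      intro g hg i
      refine Submodule.span_induction (p := fun g _ ↦ algebraMap (AT P K) _ g * Tate.tau 1 (f i) ∈
        boundedOn P L (r ^ Fintype.card F ^ (m + 1)) hr') ?_ ?_ ?_ ?_ hg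
      · rintro _ ⟨g, hg, rfl⟩
        have h := Tate.tau_algebraMap (1 : Radius L) g
        rw [RingHom.coe_coe, ← h, ← map_mul]
        exact tau_mem_boundedOn _ _ (by rw [← pow_mul, pow_succ]) (ih g hg i)
      · rw [map_zero, zero_mul]; exact zero_mem _
      · intro x y _ _ hx hy
        rw [map_add, add_mul]; exact add_mem hx hy
      · intro b x _ hx
        rw [smul_eq_mul, map_mul, mul_assoc]
        exact mul_mem (algebraMap_mem_boundedOn hr' b) hx
    intro g hg i
    rw [prod_jTwist_succ, mul_pow, ← Ideal.map_pow] at hg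
    refine Submodule.mul_induction_on hg ?_ ?_
    · intro g hg h hh
      rw [← congrFun hf i, map_mul, frobMatrix_apply, Finset.mul_sum]
      refine sum_mem fun j _ ↦ ?_
      -- The factor `h` cancels the poles of `Φ i j`, leaving an element of $A\otimes K$, which is
      -- bounded on every radius.
      obtain ⟨b, hb⟩ := hΦ h hh i j
      have : algebraMap (AT P K) (Tate P (1 : Radius L)) g * algebraMap (AT P K) _ h *
          (Φ i j * Tate.tau 1 (f j)) =
          algebraMap (AT P K) _ b * (algebraMap (AT P K) _ g * Tate.tau 1 (f j)) := by
        rw [hb]; ring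
      rw [this]
      exact mul_mem (algebraMap_mem_boundedOn hr' b) (hτ g hg j)
    · intro x y hx hy
      rw [map_add, add_mul]; exact add_mem hx hy

/-- There are functions in `A` with a pole at `∞`. -/
lemma exists_notMem_ring (P : Place F K) [IsDiscreteValuationRing P.ring]
    [IsFractionRing (regularAway P) K] : ∃ a : regularAway P, (a : K) ∉ P.ring := by
  by_contra! h
  refine P.ne_top (eq_top_iff.2 fun x _ ↦ ?_)
  obtain ⟨a, b, hb, rfl⟩ := IsFractionRing.div_surjective (A := regularAway P) x
  have hb0 : (b : K) ≠ 0 := by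
    have := nonZeroDivisors.ne_zero hb
    simpa using this
  -- If $A$ were contained in the valuation ring, its nonzero elements would all be units there, and
  -- so would contain the whole fraction field $K$ in that ring.
  have hvb : val P (b : K) = 1 := le_antisymm (val_le_one_iff.2 (h b)) (one_le_val b.2 hb0)
  change (a : K) / (b : K) ∈ P.ring
  rw [← val_le_one_iff, map_div₀, hvb, div_one]
  exact val_le_one_iff.2 (h a)

/-- For nonconstant $a$, the element $a\otimes1-1\otimes a$ lies in $\mathfrak j$, and its image
$a\otimes1-1\otimes a^{q^i}$ under $\tau^i$ lies in $\tau^i\mathfrak j$. The product over $i\le m$,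
to the power $n$, is a common denominator for sections of $\mathcal O(n\cdot J_m)$. -/
lemma exists_mem_poleSet_mem_JIdeal_pow (P : Place F K) [IsDiscreteValuationRing P.ring]
    [IsFractionRing (regularAway P) K] (m n : ℕ) : ∃ s ∈ poleSet P, s ∈ JIdeal P m ^ n := by
  obtain ⟨a, ha⟩ := exists_notMem_ring P
  refine ⟨(∏ i ∈ Finset.range (m + 1), (AT.mk a 1 - AT.mk 1 ((a : K) ^ Fintype.card F ^ i))) ^ n,
    pow_mem (Submonoid.prod_mem (poleSet P) fun i _ ↦
      Submonoid.subset_closure ⟨a, ha, i, rfl⟩) n,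
    Ideal.pow_mem_pow (Ideal.prod_mem_prod fun i _ ↦ ?_) n⟩
  have h0 : (AT.mk a 1 - AT.mk 1 (a : K) : AT P K) ∈ jIdeal P := by
    rw [jIdeal, RingHom.mem_ker, map_sub, sub_eq_zero]
    exact (Algebra.TensorProduct.productMap_apply_tmul _ _ _ _).trans
      ((by simp [mul_comm] : _ = _).trans
        (Algebra.TensorProduct.productMap_apply_tmul _ _ _ _).symm)
  have h1 : ∀ i : ℕ, ((tau P K : AT P K →+* AT P K) ^ i) (AT.mk a 1 - AT.mk 1 (a : K)) =
      AT.mk a 1 - AT.mk 1 ((a : K) ^ Fintype.card F ^ i) := by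
    intro i
    induction i with
    | zero => simp
    | succ i ih =>
      rw [pow_succ', RingHom.mul_def, RingHom.comp_apply, ih]
      simp [pow_succ, pow_mul]
  rw [← h1 i]
  exact Ideal.mem_map_of_mem _ h0

end Overconvergence

/-! ### Meromorphic functions on $\mathfrak X_\rho$ and gluing of global sections -/

section Meromorphic

variable {F K : Type*} [Field F] [Fintype F] [Field K] [Algebra F K] {P : Place F K}
  [IsDiscreteValuationRing P.ring]
variable {L : Type*} [NormedField L] [Algebra F L] [Algebra K L] [IsScalarTower F K L]

lemma Mer.restrict_algebraMap {ρ ρ' : Radius L} (h : ρ ≤ ρ') (x : Tate P ρ') :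
    Mer.restrict h (algebraMap (Tate P ρ') (Mer P ρ') x) =
      algebraMap (Tate P ρ) (Mer P ρ) (Tate.restrict h x) :=
  IsLocalization.map_eq (M := Algebra.algebraMapSubmonoid (Tate P ρ') (poleSet P))
    (T := Algebra.algebraMapSubmonoid (Tate P ρ) (poleSet P)) (Q := Mer P ρ)
    (g := (Tate.restrict (P := P) h).toRingHom) (by
      rintro _ ⟨s, hs, rfl⟩
      exact ⟨s, hs, ((Tate.restrict (P := P) h).commutes s).symm⟩) x

lemma Mer.tau_algebraMap_tate (ρ : Radius L) (x : Tate P ρ) :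
    Mer.tau ρ (algebraMap (Tate P ρ) (Mer P ρ) x) =
      algebraMap (Tate P ρ) (Mer P ρ) (Tate.tau ρ x) :=
  IsLocalization.map_eq _ _

lemma Mer.congr_of_tate {ρ : Radius L} {E : Type*} [CommRing E] {f g : Mer P ρ →+* E}
    (h : ∀ x, f (algebraMap (Tate P ρ) _ x) = g (algebraMap (Tate P ρ) _ x)) (x : Mer P ρ) :
    f x = g x :=
  congrArg (fun φ : Mer P ρ →+* E ↦ φ x)
    (IsLocalization.ringHom_ext (Algebra.algebraMapSubmonoid (Tate P ρ) (poleSet P))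
      (RingHom.ext h))

lemma Mer.restrict_restrict {ρ ρ' ρ'' : Radius L} (h : ρ ≤ ρ') (h' : ρ' ≤ ρ'') (h'' : ρ ≤ ρ'')
    (x : Mer P ρ'') : Mer.restrict h (Mer.restrict h' x) = Mer.restrict h'' x := by
  refine Mer.congr_of_tate (f := ((Mer.restrict h).comp (Mer.restrict h') : _ →ₐ[AT P K] _).toRingHom)
    (g := (Mer.restrict h'' : Mer P ρ'' →ₐ[AT P K] Mer P ρ).toRingHom) (fun y ↦ ?_) x
  rw [AlgHom.toRingHom_eq_coe, AlgHom.toRingHom_eq_coe, RingHom.coe_coe, RingHom.coe_coe,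
    AlgHom.comp_apply, restrict_algebraMap,
    restrict_algebraMap, restrict_algebraMap, Tate.restrict_restrict h h' h'']

lemma Mer.restrict_tau {ρ ρ' : Radius L} (h : ρ ≤ ρ') (x : Mer P ρ') :
    Mer.restrict h (Mer.tau ρ' x) = Mer.tau ρ (Mer.restrict h x) := by
  refine Mer.congr_of_tate
    (f := ((Mer.restrict h : _ →ₐ[AT P K] _) : Mer P ρ' →+* Mer P ρ).comp (Mer.tau ρ'))
    (g := (Mer.tau ρ).comp ((Mer.restrict h : _ →ₐ[AT P K] _) : Mer P ρ' →+* Mer P ρ))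
    (fun y ↦ ?_) x
  rw [RingHom.comp_apply, RingHom.comp_apply, RingHom.coe_coe, tau_algebraMap_tate,
    restrict_algebraMap, restrict_algebraMap, tau_algebraMap_tate, Tate.restrict_tau]

variable [IsNormedOver P L]

lemma tateEquivMer_apply (x : Tate P (1 : Radius L)) :
    tateEquivMer x = algebraMap (Tate P (1 : Radius L)) (Mer P (1 : Radius L)) x := rfl

/-- Clear the denominator: on $\mathfrak X_1$ meromorphic functions are already elements of
$L\langle A\rangle$, so injectivity for the Tate algebras kills the numerator. -/
lemma Mer.restrict_one_injective (ρ : Radius L) :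
    Function.Injective (Mer.restrict (P := P) ρ.one_le) := by
  refine (injective_iff_map_eq_zero _).2 fun x hx ↦ ?_
  obtain ⟨⟨y, s⟩, hxy⟩ := IsLocalization.surj
    (Algebra.algebraMapSubmonoid (Tate P ρ) (poleSet P)) x
  have h1 : algebraMap (Tate P (1 : Radius L)) (Mer P (1 : Radius L))
      (Tate.restrict ρ.one_le y) = 0 := by
    rw [← restrict_algebraMap, ← hxy, map_mul, hx, zero_mul]
  rw [← tateEquivMer_apply, LinearEquiv.map_eq_zero_iff,
    map_eq_zero_iff _ (Tate.restrict_one_injective ρ)] at h1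
  simp only [h1, map_zero] at hxy
  exact (IsLocalization.map_units (Mer P ρ) s).mul_left_eq_zero.1 hxy

lemma globalSections.tateEquivMer_toTate (n : ℕ) (x : globalSections P L n) :
    tateEquivMer (globalSections.toTate n x) = globalSections.eval n 1 x :=
  tateEquivMer.apply_symm_apply _

/-- Every member of a compatible family is determined by its restriction to $\mathfrak X_1$. -/
lemma globalSections.toTate_injective (n : ℕ) :
    Function.Injective (globalSections.toTate (P := P) (L := L) n) := by
  refine (injective_iff_map_eq_zero _).2 fun x hx ↦ Subtype.ext (funext fun ρ ↦ ?_)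
  have h1 : x.1 1 = 0 := by
    have := globalSections.tateEquivMer_toTate n x
    rw [hx, map_zero] at this
    exact this.symm
  refine Mer.restrict_one_injective ρ ?_
  rw [x.2.2 1 ρ ρ.one_le, h1]
  exact (map_zero _).symm

/-- A function in `L⟨A⟩` which extends to sections of `𝒪(n · J)` on all `𝔛_ρ` extends to a global
section. -/
lemma globalSections.exists_toTate_eq (n : ℕ) (f : Tate P (1 : Radius L))
    (h : ∀ ρ : Radius L, ∃ x ∈ sectionsOn n ρ,
      Mer.restrict ρ.one_le x = algebraMap (Tate P (1 : Radius L)) (Mer P (1 : Radius L)) f) :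
    ∃ x : globalSections P L n, globalSections.toTate n x = f := by
  choose x hx hxf using h
  -- The extensions were chosen independently for each radius; they agree because they agree on
  -- $\mathfrak X_1$.
  have hcompat : ∀ (ρ ρ' : Radius L) (h : ρ ≤ ρ'), Mer.restrict h (x ρ') = x ρ := by
    intro ρ ρ' h
    refine Mer.restrict_one_injective ρ ?_
    rw [Mer.restrict_restrict _ _ ρ'.one_le, hxf, hxf]
  refine ⟨⟨x, hx, hcompat⟩, (tateEquivMer (P := P) (L := L)).injective ?_⟩
  rw [globalSections.tateEquivMer_toTate, tateEquivMer_apply, ← hxf 1]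
  exact (hcompat 1 1 _).symm

/-- A criterion for a function in `L⟨A⟩` to extend to a section of `𝒪(n · J)` on `𝔛_ρ`. -/
lemma exists_sectionsOn_restrict_eq [IsFractionRing (regularAway P) K] (n m : ℕ) (ρ : Radius L)
    (f : Tate P (1 : Radius L))
    (h : ∀ g ∈ JIdeal P m ^ n, ∃ y : Tate P ρ,
      Tate.restrict ρ.one_le y = algebraMap (AT P K) _ g * f) :
    ∃ x ∈ sectionsOn n ρ,
      Mer.restrict ρ.one_le x = algebraMap (Tate P (1 : Radius L)) (Mer P (1 : Radius L)) f := by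
  -- A single denominator $s$ in the ideal defines the candidate $y/s$, where $y$ extends $sf$.
  -- Regularity of its multiples by the other elements of the ideal is then checked on $\mathfrak
  -- X_1$.
  obtain ⟨s, hs, hsJ⟩ := exists_mem_poleSet_mem_JIdeal_pow P m n
  obtain ⟨y, hy⟩ := h s hsJ
  obtain ⟨u, hu⟩ := PolesInvertible.isUnit (E := Mer P ρ) s hs
  have hx : Mer.restrict ρ.one_le (algebraMap (Tate P ρ) (Mer P ρ) y * (↑u⁻¹ : Mer P ρ)) =
      algebraMap (Tate P (1 : Radius L)) (Mer P (1 : Radius L)) f := by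
    refine (PolesInvertible.isUnit (E := Mer P (1 : Radius L)) s hs).mul_left_injective ?_
    change _ * _ = _ * _
    rw [← AlgHom.commutes (Mer.restrict (P := P) ρ.one_le), ← map_mul, ← hu, mul_assoc,
      Units.inv_mul, mul_one, Mer.restrict_algebraMap, hy, map_mul,
      ← IsScalarTower.algebraMap_apply, hu, AlgHom.commutes, mul_comm]
  refine ⟨_, ⟨m, fun g hg ↦ ?_⟩, hx⟩
  obtain ⟨z, hz⟩ := h g hg
  refine ⟨z, Mer.restrict_one_injective ρ ?_⟩
  rw [map_smul, hx, Mer.restrict_algebraMap, hz, map_mul, ← IsScalarTower.algebraMap_apply,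
    Algebra.smul_def]

end Meromorphic

/-! ### Naturality of $f\mapsto\tau_M(\tau^*f)$ -/

section Action

variable {F K : Type*} [Field F] [Fintype F] [Field K] [Algebra F K] {P : Place F K}
variable {M : Type*} [AddCommGroup M] [Module (AT P K) M] (T : MotiveStructure P M)
variable {E : Type*} [CommRing E] [Algebra (AT P K) E]

lemma MotiveStructure.act_tmul (κ : jComplement P →ₐ[AT P K] E) (σ : E →+* E)
    (hσ : ∀ b, σ (algebraMap (AT P K) E b) = algebraMap (AT P K) E (tau P K b))
    (e : E) (m : M) : T.act κ σ hσ (e ⊗ₜ m) = σ e • T.frobVec κ m := rfl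

/-- Naturality of the semilinear map `f ↦ τ_M(τ^* f)`. -/
lemma MotiveStructure.rTensor_act {E' : Type*} [CommRing E'] [Algebra (AT P K) E']
    (κ : jComplement P →ₐ[AT P K] E) (σ : E →+* E)
    (hσ : ∀ b, σ (algebraMap (AT P K) E b) = algebraMap (AT P K) E (tau P K b))
    (κ' : jComplement P →ₐ[AT P K] E') (σ' : E' →+* E')
    (hσ' : ∀ b, σ' (algebraMap (AT P K) E' b) = algebraMap (AT P K) E' (tau P K b))
    (g : E →ₐ[AT P K] E') (hκ : g.comp κ = κ') (hg : ∀ x, g (σ x) = σ' (g x))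
    (x : E ⊗[AT P K] M) :
    g.toLinearMap.rTensor M (T.act κ σ hσ x) = T.act κ' σ' hσ' (g.toLinearMap.rTensor M x) := by
  have hsmul : ∀ (e : E) (y : E ⊗[AT P K] M),
      g.toLinearMap.rTensor M (e • y) = g e • g.toLinearMap.rTensor M y := by
    intro e y
    induction y using TensorProduct.induction_on with
    | zero => simp
    | tmul a m => simp [TensorProduct.smul_tmul']
    | add y z hy hz => rw [smul_add, map_add, hy, hz, map_add, smul_add]
  induction x using TensorProduct.induction_on with
  | zero => simp
  | add x y hx hy => simp only [map_add, hx, hy]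
  | tmul e m =>
    rw [act_tmul, LinearMap.rTensor_tmul, act_tmul, hsmul, hg]
    subst hκ
    congr 1
    change g.toLinearMap.rTensor M (κ.toLinearMap.rTensor M _) = _
    rw [← LinearMap.comp_apply, ← LinearMap.rTensor_comp]
    rfl

/-- Both maps factor through the localization at `poleSet`, out of which algebra maps are unique. -/
lemma kappa_comp {E' : Type*} [CommRing E'] [Algebra (AT P K) E'] [PolesInvertible P E]
    [PolesInvertible P E'] (g : E →ₐ[AT P K] E') : g.comp (kappa P E) = kappa P E' := by
  rw [kappa, kappa, ← AlgHom.comp_assoc]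
  congr 1
  exact IsLocalization.algHom_ext (poleSet P) (by ext)

end Action

/-! ### Coordinates on finite projective modules -/

section Coordinates

variable {R M : Type*} [CommRing R] [AddCommGroup M] [Module R M]

/-- The map `E ⊗ M → E` obtained by base change from a linear form on `M`. -/
def tensorForm (E : Type*) [CommRing E] [Algebra R E] (l : M →ₗ[R] R) : E ⊗[R] M →ₗ[E] E :=
  (TensorProduct.AlgebraTensorModule.rid R E E).toLinearMap ∘ₗ l.baseChange E

lemma tensorForm_tmul {E : Type*} [CommRing E] [Algebra R E] (l : M →ₗ[R] R) (e : E) (m : M) :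
    tensorForm E l (e ⊗ₜ m) = l m • e := by
  simp [tensorForm]

lemma tensorForm_rTensor {E E' : Type*} [CommRing E] [Algebra R E] [CommRing E'] [Algebra R E']
    (g : E →ₐ[R] E') (l : M →ₗ[R] R) (x : E ⊗[R] M) :
    tensorForm E' l (g.toLinearMap.rTensor M x) = g (tensorForm E l x) := by
  induction x using TensorProduct.induction_on with
  | zero => simp
  | add x y hx hy => simp only [map_add, hx, hy]
  | tmul e m => simp [tensorForm_tmul]

/-- A finite projective module has a finite system of generators with dual coordinates. -/
lemma exists_dual_coordinates (R M : Type*) [CommRing R] [AddCommGroup M] [Module R M]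
    [Module.Finite R M] [Module.Projective R M] :
    ∃ (k : ℕ) (l : Fin k → M →ₗ[R] R) (v : Fin k → M), ∀ m, m = ∑ i, l i m • v i := by
  obtain ⟨k, f, g, -, -, hfg⟩ := Module.Finite.exists_comp_eq_id_of_projective R M
  refine ⟨k, fun i ↦ LinearMap.proj i ∘ₗ g, fun i ↦ f (Pi.single i 1), fun m ↦ ?_⟩
  conv_lhs => rw [← LinearMap.id_apply (R := R) m, ← hfg, LinearMap.comp_apply,
    ← Finset.univ_sum_single (g m), map_sum]
  refine Finset.sum_congr rfl fun i _ ↦ ?_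
  rw [← map_smul, ← Pi.single_smul]
  simp

lemma eq_sum_tensorForm {E : Type*} [CommRing E] [Algebra R E] {k : ℕ} {l : Fin k → M →ₗ[R] R}
    {v : Fin k → M} (h : ∀ m, m = ∑ i, l i m • v i) (x : E ⊗[R] M) :
    x = ∑ i, tensorForm E (l i) x ⊗ₜ v i := by
  induction x using TensorProduct.induction_on with
  | zero => simp
  | add x y hx hy =>
    conv_lhs => rw [hx, hy]
    simp only [map_add, TensorProduct.add_tmul, Finset.sum_add_distrib]
  | tmul e m =>
    conv_lhs => rw [h m]
    simp only [TensorProduct.tmul_sum, tensorForm_tmul, TensorProduct.smul_tmul]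

end Coordinates

/-! ### Extension of solutions and comparison of fixed modules -/

section Main

variable {F K : Type*} [Field F] [Fintype F] [Field K] [Algebra F K] {P : Place F K}
  [IsDiscreteValuationRing P.ring]
variable {L : Type*} [NormedField L] [Algebra F L] [Algebra K L] [IsScalarTower F K L]
  [IsNormedOver P L]
variable {M : Type*} [AddCommGroup M] [Module (AT P K) M] (T : MotiveStructure P M)

/-- The coordinates of `f = τ_M(τ^* f)` satisfy an equation `f = Φ · τ(f)`. -/
lemma MotiveStructure.frobMatrix_tensorForm {k : ℕ} {l : Fin k → M →ₗ[AT P K] AT P K}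
    {v : Fin k → M} (h : ∀ m, m = ∑ i, l i m • v i)
    (x : Tate P (1 : Radius L) ⊗[AT P K] M) :
    frobMatrix (fun i j ↦ kappa P (Tate P (1 : Radius L))
      (tensorForm (jComplement P) (l i) (T.frob (1 ⊗ₜ v j)))) (fun i ↦ tensorForm _ (l i) x) =
      fun i ↦ tensorForm _ (l i) (T.tateAct P L x) := by
  ext i
  conv_rhs => rw [eq_sum_tensorForm h x, map_sum, map_sum]
  rw [frobMatrix_apply]
  refine Finset.sum_congr rfl fun j _ ↦ ?_
  rw [tateAct, act_tmul, map_smul, smul_eq_mul, mul_comm, ← tensorForm_rTensor]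
  rfl

/-- There is a common bound for the orders of the poles along `𝔧` of finitely many elements of
`jComplement`. -/
lemma exists_forall_smul_mem_range {ι : Type*} [Finite ι] (φ : ι → jComplement P) :
    ∃ n₀ : ℕ, ∀ n ≥ n₀, ∀ i, ∀ g ∈ jIdeal P ^ n, g • φ i ∈
      (algebraMap (AT P K) (jComplement P)).range := by
  have := Fintype.ofFinite ι
  choose N hN using fun i ↦ (φ i).2
  refine ⟨∑ i, N i, fun n hn i g hg ↦ ?_⟩
  obtain ⟨b, hb⟩ := hN i g (Ideal.pow_le_pow_right
    ((Finset.single_le_sum (fun j _ ↦ Nat.zero_le (N j)) (Finset.mem_univ i)).trans hn) hg)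
  exact ⟨b, Subtype.ext hb⟩

/-- For large `n`, every solution of `f = τ_M(τ^* f)` over `L⟨A⟩` extends to a global section of
`M ⊗ 𝒪(n · J)`. -/
theorem MotiveStructure.exists_globalSections_of_tateAct_eq [IsFractionRing (regularAway P) K]
    [Module.Finite (AT P K) M] [Module.Projective (AT P K) M] :
    ∃ n₀ : ℕ, ∀ n ≥ n₀, ∀ x : Tate P (1 : Radius L) ⊗[AT P K] M, T.tateAct P L x = x →
      ∃ y : globalSections P L n ⊗[AT P K] M, (globalSections.toTate n).rTensor M y = x := by
  obtain ⟨k, l, v, hlv⟩ := exists_dual_coordinates (AT P K) M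
  let φ : Fin k × Fin k → jComplement P := fun p ↦
    tensorForm (jComplement P) (l p.1) (T.frob (1 ⊗ₜ v p.2))
  obtain ⟨n₀, hn₀⟩ := exists_forall_smul_mem_range φ
  refine ⟨n₀, fun n hn x hx ↦ ?_⟩
  let Φ : Fin k → Fin k → Tate P (1 : Radius L) := fun i j ↦ kappa P _ (φ (i, j))
  let f : Fin k → Tate P (1 : Radius L) := fun i ↦ tensorForm _ (l i) x
  have hf : frobMatrix Φ f = f := by
    refine (T.frobMatrix_tensorForm hlv x).trans ?_
    rw [hx]
  have hΦ : ∀ g ∈ jIdeal P ^ n, ∀ i j, algebraMap (AT P K) _ g * Φ i j ∈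
      (algebraMap (AT P K) (Tate P (1 : Radius L))).range := by
    intro g hg i j
    obtain ⟨b, hb⟩ := hn₀ n hn (i, j) g hg
    refine ⟨b, ?_⟩
    rw [← AlgHom.commutes (kappa P (Tate P (1 : Radius L))), hb, map_smul, Algebra.smul_def]
  -- The matrix has finitely many entries, hence a common radius and a common bound.
  obtain ⟨r₀, hr₀, C₀, hC₀, hΦ₀⟩ := exists_forall_mem_tball
    (fun p : Fin k × Fin k ↦ Φ p.1 p.2) (fun p ↦ exists_kappa_mem_tball (φ p))
  obtain ⟨r, hr, C, hC, hfr⟩ := exists_mem_tball_of_frobMatrix_eq hr₀ hC₀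
    (fun i j ↦ hΦ₀ (i, j)) hf
  have hext : ∀ i, ∃ y : globalSections P L n, globalSections.toTate n y = f i := by
    refine fun i ↦ globalSections.exists_toTate_eq n (f i) fun ρ ↦ ?_
    -- Boundedness on radius $\rho^2$ yields convergence on $\mathfrak X_\rho$, and $r^m\le
    -- r^{q^{m+1}}$. The continuation is run $m+1$ times because the ideal of $J_m$ has $m+1$
    -- factors.
    obtain ⟨m, hm⟩ := pow_unbounded_of_one_lt (ρ.1 ^ 2) hr
    refine exists_sectionsOn_restrict_eq n m ρ (f i) fun g hg ↦ ?_
    obtain ⟨D, hD, h⟩ := algebraMap_mul_mem_boundedOn hΦ hf hr.le (fun i ↦ ⟨C, hC, hfr i⟩)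
      (m + 1) g hg i
    refine exists_restrict_eq_of_mem_tball ρ (hm.le.trans (pow_le_pow_right₀ hr.le ?_)) hD h
    exact m.le_succ.trans (Nat.lt_pow_self Fintype.one_lt_card).le
  choose y hy using hext
  refine ⟨∑ i, y i ⊗ₜ v i, ?_⟩
  rw [map_sum]
  simp only [LinearMap.rTensor_tmul, hy]
  exact (eq_sum_tensorForm hlv x).symm

/-- Naturality for the localization map, which on $\mathfrak X_1$ is the identification
`tateEquivMer`. -/
lemma MotiveStructure.merAct_one_tateEquivMer (x : Tate P (1 : Radius L) ⊗[AT P K] M) :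
    T.merAct 1 (tateEquivMer.toLinearMap.rTensor M x) =
      tateEquivMer.toLinearMap.rTensor M (T.tateAct P L x) :=
  (T.rTensor_act _ _ _ _ _ _ (IsScalarTower.toAlgHom (AT P K) (Tate P (1 : Radius L))
    (Mer P (1 : Radius L))) (kappa_comp _) (fun y ↦ (Mer.tau_algebraMap_tate 1 y).symm) x).symm

lemma MotiveStructure.rTensor_restrict_merAct {ρ ρ' : Radius L} (h : ρ ≤ ρ')
    (x : Mer P ρ' ⊗[AT P K] M) :
    (Mer.restrict h).toLinearMap.rTensor M (T.merAct ρ' x) =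
      T.merAct ρ ((Mer.restrict h).toLinearMap.rTensor M x) :=
  T.rTensor_act _ _ _ _ _ _ (Mer.restrict h) (kappa_comp _) (Mer.restrict_tau h) x

/-- A section of `M ⊗ 𝒪(n · J)` on `𝔛_L` solves `f = τ_M(τ^* f)` if and only if its restriction
to `L⟨A⟩` does. -/
lemma MotiveStructure.mem_globalFixed_iff [Module.Flat (AT P K) M] (n : ℕ)
    (x : globalSections P L n ⊗[AT P K] M) :
    x ∈ T.globalFixed L n ↔ (globalSections.toTate n).rTensor M x ∈ T.tateFixed L := by
  have key : tateEquivMer.toLinearMap.rTensor M ((globalSections.toTate n).rTensor M x) =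
      (globalSections.eval n 1).rTensor M x := by
    rw [← LinearMap.comp_apply, ← LinearMap.rTensor_comp]
    congr 2
    ext y
    exact globalSections.tateEquivMer_toTate n y
  have hinj : Function.Injective
      ((tateEquivMer (P := P) (L := L)).toLinearMap.rTensor M) :=
    Module.Flat.rTensor_preserves_injective_linearMap _ (LinearEquiv.injective _)
  have h1 : (globalSections.toTate n).rTensor M x ∈ T.tateFixed L ↔
      T.merAct 1 ((globalSections.eval n 1).rTensor M x) =
        (globalSections.eval n 1).rTensor M x := by
    rw [← key, merAct_one_tateEquivMer, hinj.eq_iff]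
    rfl
  rw [h1]
  -- The equation on $\mathfrak X_1$ implies it on $\mathfrak X_\rho$: restriction commutes with the
  -- action and remains injective after tensoring with the flat module $M$.
  refine ⟨fun h ↦ h 1, fun h ρ ↦ ?_⟩
  have hρ : (Mer.restrict ρ.one_le).toLinearMap.rTensor M
      ((globalSections.eval n ρ).rTensor M x) = (globalSections.eval n 1).rTensor M x := by
    rw [← LinearMap.comp_apply, ← LinearMap.rTensor_comp]
    congr 2
    ext y
    exact y.2.2 1 ρ ρ.one_le
  refine Module.Flat.rTensor_preserves_injective_linearMap (M := M)
    (Mer.restrict (P := P) ρ.one_le).toLinearMap (Mer.restrict_one_injective ρ) ?_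
  rw [rTensor_restrict_merAct, hρ, h]

/-- A bijection between `A`-submodules induced by an injective map of `A ⊗ K`-modules. -/
lemma exists_linearEquiv_of_injective {X Y : Type*} [AddCommMonoid X] [Module (AT P K) X]
    [Module (regularAway P) X] [IsScalarTower (regularAway P) (AT P K) X]
    [AddCommMonoid Y] [Module (AT P K) Y]
    [Module (regularAway P) Y] [IsScalarTower (regularAway P) (AT P K) Y]
    (g : X →ₗ[AT P K] Y) (hg : Function.Injective g) (U : Submodule (regularAway P) X)
    (V : Submodule (regularAway P) Y) (hUV : ∀ x, x ∈ U ↔ g x ∈ V)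
    (hV : ∀ y ∈ V, ∃ x, g x = y) : ∃ e : U ≃ₗ[regularAway P] V, ∀ x, (e x).1 = g x.1 := by
  refine ⟨LinearEquiv.ofBijective ((g.restrictScalars (regularAway P)).restrict
    fun x hx ↦ (hUV x).1 hx) ⟨fun x y h ↦ Subtype.ext (hg (congrArg Subtype.val h)), ?_⟩,
    fun x ↦ rfl⟩
  rintro ⟨y, hy⟩
  obtain ⟨x, rfl⟩ := hV y hy
  exact ⟨⟨x, (hUV x).2 hy⟩, rfl⟩

/-- For large `n`, restriction is an isomorphism between the solutions of `f = τ_M(τ^* f)` over `𝔛_L`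
with poles bounded by `n · J` and the solutions over `L⟨A⟩`. -/
theorem MotiveStructure.exists_globalFixed_equiv_tateFixed [IsFractionRing (regularAway P) K]
    [Module.Finite (AT P K) M] [Module.Projective (AT P K) M] :
    ∃ n₀ : ℕ, ∀ n ≥ n₀, ∃ e : T.globalFixed L n ≃ₗ[regularAway P] T.tateFixed L,
      ∀ x, (e x).1 = (globalSections.toTate n).rTensor M x.1 := by
  obtain ⟨n₀, hn₀⟩ := T.exists_globalSections_of_tateAct_eq (L := L)
  refine ⟨n₀, fun n hn ↦ ?_⟩
  have hinj := Module.Flat.rTensor_preserves_injective_linearMap (M := M)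
    (globalSections.toTate (P := P) (L := L) n) (globalSections.toTate_injective n)
  exact exists_linearEquiv_of_injective ((globalSections.toTate (P := P) (L := L) n).rTensor M)
    hinj (T.globalFixed L n) (T.tateFixed L) (T.mem_globalFixed_iff (L := L) n) (hn₀ n hn)

end Main

end AMotive
end

/-! ### The main theorem -/

theorem mainTheorem11 {F K : Type*} [Field F] [Fintype F] [Field K] [Algebra F K]
    (hK : AMotive.IsCurveFunctionField F K)
    (P : AMotive.Place F K) [IsDiscreteValuationRing P.ring]
    [IsFractionRing (AMotive.regularAway P) K]
    {M : Type*} [AddCommGroup M] [Module (AMotive.AT P K) M]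
    [Module.Finite (AMotive.AT P K) M] [Module.Projective (AMotive.AT P K) M]
    (T : AMotive.MotiveStructure P M) (hT : T.IsRigidAnalyticallyTrivial)
    (L : IntermediateField (AMotive.Kinf P) (AMotive.Ksep P))
    [FiniteDimensional (AMotive.Kinf P) L]
    (hL : ∀ ω ∈ T.betti, ω ∈ LinearMap.range
      ((AMotive.Tate.toCinf L).toLinearMap.rTensor M)) :
    (∃ e : T.tateFixed L ≃ₗ[AMotive.regularAway P] T.betti,
      ∀ x, (e x).1 = (AMotive.Tate.toCinf L).toLinearMap.rTensor M x.1) ∧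
    ∃ n₀ : ℕ, ∀ n ≥ n₀, ∃ e : T.globalFixed L n ≃ₗ[AMotive.regularAway P] T.tateFixed L,
      ∀ x, (e x).1 = (AMotive.globalSections.toTate n).rTensor M x.1 := by
  constructor
  -- The inclusion of Tate algebras is isometric, hence injective, and $M$ is flat. Surjectivity
  -- onto $M_B$ is the assumption on $L$, since by injectivity a preimage of a solution is again a
  -- solution.
  · have hinj : Function.Injective ((AMotive.Tate.toCinf L).toLinearMap.rTensor M) :=
      Module.Flat.rTensor_preserves_injective_linearMap _
        (AMotive.Tate.baseChange_injective (P := P) (AMotive.inclCinf L)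
          fun x ↦ AMotive.norm_algebraMap_Cinf P (x : AMotive.Ksep P))
    refine AMotive.exists_linearEquiv_of_injective _ hinj _ _ (fun x ↦ ?_) hL
    have h := T.rTensor_act _ _ (AMotive.Tate.tau_algebraMap 1) _ _
      (AMotive.Tate.tau_algebraMap 1) (AMotive.Tate.toCinf L) (AMotive.kappa_comp _)
      (AMotive.Tate.baseChange_tau (P := P) (AMotive.inclCinf L)
          fun x ↦ AMotive.norm_algebraMap_Cinf P (x : AMotive.Ksep P)) x
    refine (hinj.eq_iff (a := T.tateAct P L x) (b := x)).symm.trans ?_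
    exact Eq.congr_left h
  · exact T.exists_globalFixed_equiv_tateFixed
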